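/- Conventions. A transfer function is an $n\times n$ matrix $G(s)$ of complex rational functions, always assumed strictly proper; it is symmetric if $G(s)^t=G(s)$ and Hamiltonian if $G(-s)^t=G(s)$. Its McMillan degree $\delta$ is the least $d$ such that $G(s)=C(sI_d-A)^{-1}B$ with complex matrices $A\in\mathbb C^{d\times d}$, $B\in\mathbb C^{d\times n}$, $C\in\mathbb C^{n\times d}$; its characteristic polynomial is $\det(sI-A)$ for such a realization with $d=\delta$. (Hamiltonian transfer functions always have even McMillan degree.) For a symmetric matrix $F$ let $G_F(s)=(I_n-G(s)F)^{-1}G(s)$. The admissible polynomials of degree $\delta$ are all monic $\varphi\in\mathbb C[s]$ of degree $\delta$ in the symmetric case, and those with $\varphi(-s)=\varphi(s)$ in the Hamiltonian case. $G$ of McMillan degree $\delta$ is pole assignable by complex symmetric feedback if for every admissible $\varphi$ of degree $\delta$ there is $F=F^t\in\mathbb C^{n\times n}$ such that $G_F$ has characteristic polynomial $\varphi$; it is pole assignable by real symmetric feedback if for every admissible $\varphi$ with real coefficients there is such an $F=F^t\in\mathbb R^{n\times n}$. $G$ is generically pole assignable by complex symmetric feedback if such an $F=F^t\in\mathbb C^{n\times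 n}$ exists for all $\varphi$ in a Zariski open and dense subset of the affine space of admissible polynomials (with their coefficients as coordinates). The set of symmetric (or Hamiltonian) transfer functions of McMillan degree $\delta$ carries the Zariski topology induced by the embedding $G\mapsto(H_0,\dots,H_{2\delta-1})$, where $G(s)=\sum_{k\ge0}H_ks^{-k-1}$ near $s=\infty$. Theorem. Let $n,\delta\ge 0$ be integers. (1) If $\delta>\binom{n+1}{2}$ (or $\delta>n(n+1)$), then no $n\times n$ symmetric (or Hamiltonian, respectively) transfer function of McMillan degree $\delta$ is pole assignable by complex symmetric feedback, and none is pole assignable by real symmetric feedback. (2) If $\delta\le\binom{n+1}{2}$ (or $\delta\le n(n+1)$), then the set of $n\times n$ symmetric (or Hamiltonian, respectively) transfer functions of McMillan degree $\delta$ contains a Zariski open and dense subset, nonempty in the symmetric case and, for even $\delta$, in the Hamiltonian case, all of whose elements are generically pole assignable by complex symmetric feedback. -/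

import Mathlib

open Polynomial

noncomputable section

namespace PoleAssignment

/-- A matrix of rational functions over `ℂ`, that is, an `n × n` transfer function `G(s)`. -/
abbrev TransferFunction (n : ℕ) : Type := Matrix (Fin n) (Fin n) (RatFunc ℂ)

/-- Every entry is strictly proper: numerator degree less than denominator degree
(the zero function has `num = 0`, of degree `⊥`, and `denom = 1`). -/
def StrictlyProper {n : ℕ} (G : TransferFunction n) : Prop :=
  ∀ i j, (G i j).num.degree < (G i j).denom.degree

/-- `(A, B, C)` is a realization of `G`, that is, `G(s) = C (s I - A)⁻¹ B`.
The matrix `s I - A` is `Matrix.charmatrix A`; it is invertible over `ℂ(s)`. -/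
def IsRealization {n d : ℕ} (G : TransferFunction n) (A : Matrix (Fin d) (Fin d) ℂ)
    (B : Matrix (Fin d) (Fin n) ℂ) (C : Matrix (Fin n) (Fin d) ℂ) : Prop :=
  G = C.map (RatFunc.C (K := ℂ)) * (A.charmatrix.map (algebraMap ℂ[X] (RatFunc ℂ)))⁻¹ *
    B.map (RatFunc.C (K := ℂ))

/-- The strictly proper transfer function `G` has McMillan degree `δ`: the least state space
dimension of a realization of `G` is `δ`. -/
def HasMcMillanDegree {n : ℕ} (G : TransferFunction n) (δ : ℕ) : Prop :=
  IsLeast {d : ℕ | ∃ (A : Matrix (Fin d) (Fin d) ℂ) (B : Matrix (Fin d) (Fin n) ℂ)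
    (C : Matrix (Fin n) (Fin d) ℂ), IsRealization G A B C} δ

/-- `φ` is the characteristic polynomial (pole polynomial) of `G`: it is `det (s I - A)` for a
realization `(A, B, C)` of `G` of minimal dimension. -/
def HasCharacteristicPolynomial {n : ℕ} (G : TransferFunction n) (φ : ℂ[X]) : Prop :=
  ∃ (d : ℕ) (A : Matrix (Fin d) (Fin d) ℂ) (B : Matrix (Fin d) (Fin n) ℂ)
    (C : Matrix (Fin n) (Fin d) ℂ),
    HasMcMillanDegree G d ∧ IsRealization G A B C ∧ A.charpoly = φ

/-- `G(-s)`, entrywise. -/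
def reflect {n : ℕ} (G : TransferFunction n) : TransferFunction n :=
  G.map fun f => RatFunc.eval (RatFunc.C (K := ℂ)) (-RatFunc.X) f

/-- The strictly proper symmetric (`G(s)ᵗ = G(s)`) `n × n` transfer functions of McMillan
degree `δ`. -/
def symmetricTransferFunctions (δ n : ℕ) : Set (TransferFunction n) :=
  {G | G.transpose = G ∧ StrictlyProper G ∧ HasMcMillanDegree G δ}

/-- The strictly proper Hamiltonian (`G(-s)ᵗ = G(s)`) `n × n` transfer functions of McMillan
degree `δ`. -/
def hamiltonianTransferFunctions (δ n : ℕ) : Set (TransferFunction n) :=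
  {G | (reflect G).transpose = G ∧ StrictlyProper G ∧ HasMcMillanDegree G δ}

/-- The closed loop transfer function `G_F(s) = (I - G(s) F)⁻¹ G(s)`. For strictly proper `G` the
matrix `I - G(s) F` is invertible over `ℂ(s)`, as it tends to `I` for `s → ∞`. -/
def closedLoop {n : ℕ} (G : TransferFunction n) (F : Matrix (Fin n) (Fin n) ℂ) :
    TransferFunction n :=
  (1 - G * F.map (RatFunc.C (K := ℂ)))⁻¹ * G

/-- The admissible polynomials for symmetric transfer functions: monic of degree `δ`. -/
def monicPolynomials (δ : ℕ) : Set ℂ[X] :=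
  {φ | φ.Monic ∧ φ.natDegree = δ}

/-- The admissible polynomials for Hamiltonian transfer functions: monic of degree `δ` and even. -/
def evenMonicPolynomials (δ : ℕ) : Set ℂ[X] :=
  {φ | φ.Monic ∧ φ.natDegree = δ ∧ φ.comp (-X) = φ}

/-- `φ` is the closed loop characteristic polynomial for some complex symmetric feedback. -/
def Assignable {n : ℕ} (G : TransferFunction n) (φ : ℂ[X]) : Prop :=
  ∃ F : Matrix (Fin n) (Fin n) ℂ,
    F.IsSymm ∧ HasCharacteristicPolynomial (closedLoop G F) φ

/-- `φ` is the closed loop characteristic polynomial for some real symmetric feedback. -/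
def RealAssignable {n : ℕ} (G : TransferFunction n) (φ : ℂ[X]) : Prop :=
  ∃ F : Matrix (Fin n) (Fin n) ℝ,
    F.IsSymm ∧ HasCharacteristicPolynomial (closedLoop G (F.map Complex.ofRealHom)) φ

/-- Pole assignability by complex symmetric feedback: every admissible polynomial `φ ∈ Φ` can be
assigned. -/
def PoleAssignable {n : ℕ} (Φ : Set ℂ[X]) (G : TransferFunction n) : Prop :=
  ∀ φ ∈ Φ, Assignable G φ

/-- Pole assignability by real symmetric feedback: every admissible polynomial with real
coefficients can be assigned. -/
def RealPoleAssignable {n : ℕ} (Φ : Set ℂ[X]) (G : TransferFunction n) : Prop :=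
  ∀ φ : ℝ[X], φ.map Complex.ofRealHom ∈ Φ → RealAssignable G (φ.map Complex.ofRealHom)

/-- `U` is a Zariski open subset of `S`, where `c` gives coordinates in the affine space `ℂ^ι` on
the elements of `S` and `S` has the induced topology: `U` is the set of points of `S` at which not
all members of some set `P` of polynomials vanish. -/
def IsZariskiOpenIn {T ι : Type} (c : T → ι → ℂ) (S U : Set T) : Prop :=
  ∃ P : Set (MvPolynomial ι ℂ), U = {x ∈ S | ∃ p ∈ P, MvPolynomial.eval (c x) p ≠ 0}

/-- `U` is a generic subset of `S`: Zariski open and Zariski dense in `S`. -/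
def IsGenericIn {T ι : Type} (c : T → ι → ℂ) (S U : Set T) : Prop :=
  IsZariskiOpenIn c S U ∧
    ∀ V : Set T, IsZariskiOpenIn c S V → V.Nonempty → (U ∩ V).Nonempty

/-- The non-leading coefficients of a monic polynomial of degree `δ`. -/
def coeffCoords (δ : ℕ) (φ : ℂ[X]) (i : Fin δ) : ℂ := φ.coeff i

/-- The coefficient `h_k` in the expansion `f = ∑_{k ≥ 0} h_k s^{-(k+1)}` at `s = ∞` of a strictly
proper rational function `f`: it is the constant term of the polynomial part of `s^{k+1} f(s)`,
and the polynomial part of a fraction is the quotient of numerator by denominator. -/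
def markovParameter (f : RatFunc ℂ) (k : ℕ) : ℂ :=
  ((f.num * X ^ (k + 1)) /ₘ f.denom).coeff 0

/-- The first `2δ` Markov parameters `H_0, …, H_{2δ-1}` of `G(s) = ∑ H_k s^{-(k+1)}`. They determine
a strictly proper `G` of McMillan degree `δ`, and they embed the set of these `G` as a
quasi-affine variety in the affine space of sequences of `2δ` complex `n × n` matrices. -/
def markovCoords (δ : ℕ) {n : ℕ} (G : TransferFunction n) (t : Fin (2 * δ) × Fin n × Fin n) : ℂ :=
  markovParameter (G t.2.1 t.2.2) t.1

/-- Generic pole assignability by complex symmetric feedback: all `φ` in a generic subset of the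
set `Φ` of admissible polynomials of degree `δ` can be assigned. -/
def GenericallyPoleAssignable {n : ℕ} (δ : ℕ) (Φ : Set ℂ[X]) (G : TransferFunction n) : Prop :=
  ∃ W : Set ℂ[X], IsGenericIn (coeffCoords δ) Φ W ∧ ∀ φ ∈ W, Assignable G φ

end PoleAssignment

end

open Polynomial

noncomputable section

namespace PoleAssignment

/-! Fix a minimal realization (A, B, C) of G. Feedback F replaces A by A + BFC, so the subject is
the polynomial map F ↦ charpoly(A + BFC) on symmetric matrices, an affine space of dimension
n(n+1)/2. A self-dual G has a minimal realization (SK, SCᵗ, C) with K symmetric and S invertible,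
symmetric or skew (`exists_selfDual_realization`). Hence symmetric feedback keeps the polynomial
admissible, and δ is even in the Hamiltonian case. Admissible polynomials have m free coefficients,
where m = δ or m = δ/2. The flag `h` with `sign` and `stride` treats both cases at once.

If m > n(n+1)/2, the m closed loop coefficients satisfy a nontrivial polynomial relation, and some
real admissible polynomial violates it (`exists_not_assignable`).

If m ≤ n(n+1)/2, it is enough that the map be dominant: by Chevalley's theorem its image then
contains a nonempty open set. By the Jacobian criterion a nonsingular derivative at F = 0 along m
directions suffices. Jacobi's formula expresses this derivative by the numerators of G over
charpoly(A). Expanding these fractions at infinity reduces the claim to a nonzero m × m determinant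
of entries of the symmetric Markov parameters (`genericallyPoleAssignable_of_det_ne_zero`). This is
an open condition on G. It also bounds the McMillan degree from below
(`le_of_det_markovMinor_ne_zero`), so density follows by joining an arbitrary self-dual system by a
line to an explicit system that satisfies it (`isGenericIn_good`). -/

/-! ### Algebraic independence and images of polynomial maps -/

/-- The Jacobian criterion for algebraic independence in characteristic zero. -/
theorem algebraicIndependent_of_det_pderiv_ne_zero {K σ : Type*} [Field K] [CharZero K]
    [Fintype σ] [DecidableEq σ] (p : σ → MvPolynomial σ K) (z : σ → K)
    (h : (Matrix.of fun i j => MvPolynomial.eval z (MvPolynomial.pderiv j (p i))).det ≠ 0) :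
    AlgebraicIndependent K p := by
  set M : Matrix σ σ (MvPolynomial σ K) := Matrix.of fun i j => MvPolynomial.pderiv j (p i) with hM
  have hdet : M.det ≠ 0 := by
    intro h0
    apply h
    have := congrArg (MvPolynomial.eval z) h0
    rwa [RingHom.map_det, map_zero] at this
  have chain (Q : MvPolynomial σ K) (j : σ) : MvPolynomial.pderiv j (MvPolynomial.aeval p Q) =
      ∑ i, MvPolynomial.aeval p (MvPolynomial.pderiv i Q) * MvPolynomial.pderiv j (p i) := by
    induction Q using MvPolynomial.induction_on with
    | C a => simp
    | add f g hf hg => simp only [map_add, hf, hg, add_mul, Finset.sum_add_distrib]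
    | mul_X f n hf =>
      simp only [map_mul, MvPolynomial.aeval_X, Derivation.leibniz, smul_eq_mul, hf,
        MvPolynomial.pderiv_X, map_add, add_mul, Finset.sum_add_distrib, Finset.mul_sum]
      congr 1
      · rw [Finset.sum_eq_single n]
        · simp
        · intro b _ hb
          simp [Pi.single_eq_of_ne hb.symm]
        · simp
      · exact Finset.sum_congr rfl fun i _ => by ring
  have deg (Q : MvPolynomial σ K) (n : ℕ) (hQ : Q.totalDegree ≤ n + 1) (i : σ) :
      (MvPolynomial.pderiv i Q).totalDegree ≤ n := by
    refine Finset.sup_le fun m hm => ?_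
    rw [MvPolynomial.mem_support_iff, MvPolynomial.coeff_pderiv] at hm
    have h1 := (MvPolynomial.le_totalDegree
      (MvPolynomial.mem_support_iff.mpr (left_ne_zero_of_mul hm))).trans hQ
    rw [Finsupp.sum_add_index' (by simp) (by simp)] at h1
    simpa using h1
  have const (Q : MvPolynomial σ K) (hQ : ∀ i, MvPolynomial.pderiv i Q = 0) :
      Q = MvPolynomial.C (MvPolynomial.coeff 0 Q) := by
    ext m
    rw [MvPolynomial.coeff_C]
    split_ifs with hm
    · rw [hm]
    · obtain ⟨i, hi⟩ := Finsupp.ne_iff.mp (Ne.symm hm)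
      have h1 := congrArg (MvPolynomial.coeff (m - Finsupp.single i 1)) (hQ i)
      rw [MvPolynomial.coeff_pderiv, tsub_add_cancel_of_le
        (Finsupp.single_le_iff.mpr (Nat.one_le_iff_ne_zero.mpr hi)), MvPolynomial.coeff_zero] at h1
      exact (mul_eq_zero.mp h1).resolve_right (Nat.cast_add_one_ne_zero _)
  -- Descent on the degree: differentiating Q(p) = 0 puts the values ∂ᵢQ(p) into the left kernel of
  -- the Jacobian matrix. So every ∂ᵢQ is a relation of lower degree, hence zero, and in
  -- characteristic zero Q is constant.
  have main : ∀ n (Q : MvPolynomial σ K), Q.totalDegree ≤ n → MvPolynomial.aeval p Q = 0 →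
      Q = 0 := by
    intro n
    induction n with
    | zero =>
      intro Q hQ h0
      rw [MvPolynomial.totalDegree_eq_zero_iff_eq_C.mp (Nat.le_zero.mp hQ)] at h0 ⊢
      simpa using h0
    | succ n ih =>
      intro Q hQ h0
      have hv : Matrix.vecMul (fun i => MvPolynomial.aeval p (MvPolynomial.pderiv i Q)) M = 0 := by
        funext j
        have := chain Q j
        rw [h0, map_zero] at this
        exact this.symm
      have hv0 := Matrix.eq_zero_of_vecMul_eq_zero hdet hv
      rw [const Q fun i => ih _ (deg Q n hQ i) (congrFun hv0 i)] at h0 ⊢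
      simpa using h0
  rw [algebraicIndependent_iff]
  exact fun Q hQ => main _ Q le_rfl hQ

/-- A dominant polynomial map over an algebraically closed field hits every point of a nonempty
basic open set. -/
theorem exists_eval_eq_of_algebraicIndependent {K σ τ : Type*} [Field K] [IsAlgClosed K]
    [Finite σ] [Finite τ] (p : τ → MvPolynomial σ K) (hp : AlgebraicIndependent K p) :
    ∃ Q : MvPolynomial τ K, Q ≠ 0 ∧ ∀ y, MvPolynomial.eval y Q ≠ 0 →
      ∃ x, ∀ i, MvPolynomial.eval x (p i) = y i := by
  set f : MvPolynomial τ K →ₐ[K] MvPolynomial σ K := MvPolynomial.aeval p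
  have hinj : Function.Injective f := hp
  -- Finite presentation is what Chevalley's theorem needs to make the image of the map on spectra
  -- constructible.
  have hfp : f.toRingHom.FinitePresentation :=
    RingHom.FinitePresentation.of_comp_finiteType (MvPolynomial.C : K →+* MvPolynomial τ K)
      (by
        have : f.toRingHom.comp MvPolynomial.C = algebraMap K (MvPolynomial σ K) := by
          ext; simp
        rw [this]
        exact RingHom.finitePresentation_algebraMap.mpr inferInstance)
      (RingHom.finiteType_algebraMap.mpr inferInstance)
  obtain ⟨S, hS⟩ := PrimeSpectrum.exists_constructibleSetData_iff.mpr
    (PrimeSpectrum.isConstructible_range_comap hfp)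
  -- Injectivity puts the generic point into the image. A constructible piece V(g) \ V(f) that
  -- contains the generic point has g = 0 and f ≠ 0, so it is the basic open set D(f).
  have hbot : (⊥ : PrimeSpectrum (MvPolynomial τ K)) ∈
      Set.range (PrimeSpectrum.comap f.toRingHom) := by
    refine ⟨⊥, PrimeSpectrum.ext ?_⟩
    exact Ideal.comap_bot_of_injective f.toRingHom hinj
  rw [← hS] at hbot
  obtain ⟨D, hD, hg, hf⟩ := Set.mem_iUnion₂.mp hbot
  have hDf : D.f ≠ 0 := fun h => hf (by rw [h]; exact Set.singleton_subset_iff.mpr (zero_mem _))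
  have hDg : ∀ i, D.g i = 0 := fun i => by
    have := hg (Set.mem_range_self i)
    exact this
  refine ⟨D.f, hDf, fun y hy => ?_⟩
  have hmem : MvPolynomial.pointToPoint (k := K) y ∈
      Set.range (PrimeSpectrum.comap f.toRingHom) := by
    rw [← hS]
    refine Set.mem_iUnion₂.mpr ⟨D, hD, ?_, ?_⟩
    · rintro _ ⟨i, rfl⟩
      rw [hDg]
      exact zero_mem _
    · intro h
      have := Set.singleton_subset_iff.mp h
      exact hy (by simpa [MvPolynomial.aeval_eq_eval] using
        (MvPolynomial.mem_vanishingIdeal_singleton_iff (k := K) y D.f).mp this)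
  obtain ⟨P, hP⟩ := hmem
  -- P is a prime over the closed point y, not yet a closed point. A maximal ideal above P is a
  -- point x by the Nullstellensatz, and it still contains each pᵢ − yᵢ.
  obtain ⟨N, hN, hPN⟩ := Ideal.exists_le_maximal P.asIdeal P.2.ne_top
  obtain ⟨x, rfl⟩ := MvPolynomial.isMaximal_iff_eq_vanishingIdeal_singleton.mp hN
  refine ⟨x, fun i => ?_⟩
  have h1 : (MvPolynomial.X i - MvPolynomial.C (y i) : MvPolynomial τ K) ∈
      (MvPolynomial.pointToPoint (k := K) y).asIdeal :=
    (MvPolynomial.mem_vanishingIdeal_singleton_iff (k := K) y _).mpr (by simp)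
  rw [← hP] at h1
  have h2 := (MvPolynomial.mem_vanishingIdeal_singleton_iff (k := K) x _).mp (hPN h1)
  simpa [f, sub_eq_zero, MvPolynomial.aeval_eq_eval] using h2

/-- More than `card σ` polynomials in the variables `σ` satisfy a polynomial relation. -/
theorem exists_aeval_eq_zero_of_card_lt {K σ τ : Type} [Field K] [Fintype σ] [Fintype τ]
    (h : Fintype.card σ < Fintype.card τ) (p : τ → MvPolynomial σ K) :
    ∃ Q : MvPolynomial τ K, Q ≠ 0 ∧ MvPolynomial.aeval p Q = 0 := by
  have hp : ¬ AlgebraicIndependent K p := by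
    intro hp
    have := hp.cardinalMk_le_trdeg
    rw [MvPolynomial.trdeg_of_isDomain] at this
    simp at this
    omega
  rw [algebraicIndependent_iff] at hp
  push Not at hp
  obtain ⟨Q, h1, h2⟩ := hp
  exact ⟨Q, h2, h1⟩

/-! ### State space systems, their resolvents and Markov parameters -/

section Resolvent

variable {ι κ : Type*} [Fintype ι] [DecidableEq ι] [Fintype κ] [DecidableEq κ] {n : ℕ}

/-- The matrix `s I - A` over `ℂ(s)`. -/
def pencil (A : Matrix ι ι ℂ) : Matrix ι ι (RatFunc ℂ) :=
  A.charmatrix.map (algebraMap ℂ[X] (RatFunc ℂ))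

/-- The transfer function `C (s I - A)⁻¹ B` of a state space system. -/
def transferFunction (A : Matrix ι ι ℂ) (B : Matrix ι (Fin n) ℂ) (C : Matrix (Fin n) ι ℂ) :
    TransferFunction n :=
  C.map (RatFunc.C (K := ℂ)) * (pencil A)⁻¹ * B.map (RatFunc.C (K := ℂ))

theorem isRealization_iff {d : ℕ} {G : TransferFunction n} {A : Matrix (Fin d) (Fin d) ℂ}
    {B : Matrix (Fin d) (Fin n) ℂ} {C : Matrix (Fin n) (Fin d) ℂ} :
    IsRealization G A B C ↔ G = transferFunction A B C := Iff.rfl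

theorem pencil_eq (A : Matrix ι ι ℂ) :
    pencil A = Matrix.scalar ι RatFunc.X - A.map (RatFunc.C (K := ℂ)) := by
  ext i j
  by_cases hij : i = j
  · subst hij
    simp [pencil]
  · simp [pencil, hij]

theorem det_pencil (A : Matrix ι ι ℂ) :
    (pencil A).det = algebraMap ℂ[X] (RatFunc ℂ) A.charpoly := by
  rw [pencil, Matrix.charpoly, RingHom.map_det]
  rfl

theorem isUnit_det_pencil (A : Matrix ι ι ℂ) : IsUnit (pencil A).det := by
  rw [det_pencil, isUnit_iff_ne_zero]
  exact RatFunc.algebraMap_ne_zero A.charpoly_monic.ne_zero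

theorem map_mul_C {l m o : Type*} [Fintype m] (M : Matrix l m ℂ) (N : Matrix m o ℂ) :
    (M * N).map (RatFunc.C (K := ℂ)) = M.map (RatFunc.C (K := ℂ)) * N.map (RatFunc.C (K := ℂ)) :=
  Matrix.map_mul

/-- Systems related by an intertwining matrix have the same transfer function. -/
theorem transferFunction_eq_of_intertwining {A : Matrix ι ι ℂ} {B : Matrix ι (Fin n) ℂ}
    {C : Matrix (Fin n) ι ℂ} {A' : Matrix κ κ ℂ} {B' : Matrix κ (Fin n) ℂ}
    {C' : Matrix (Fin n) κ ℂ} (P : Matrix ι κ ℂ) (hA : A * P = P * A') (hB : P * B' = B)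
    (hC : C * P = C') : transferFunction A B C = transferFunction A' B' C' := by
  set P' := P.map (RatFunc.C (K := ℂ))
  -- P intertwines the pencils and therefore their inverses. It need be neither square nor
  -- invertible, so the argument also covers quotients and subspaces of the state space.
  have h1 : pencil A * P' = P' * pencil A' := by
    rw [pencil_eq, pencil_eq, Matrix.sub_mul, Matrix.mul_sub, ← map_mul_C, hA, map_mul_C]
    congr 1
    ext i j
    simp [mul_comm]
  have h2 : P' * (pencil A')⁻¹ = (pencil A)⁻¹ * P' := by
    calc P' * (pencil A')⁻¹ = (pencil A)⁻¹ * (pencil A * P') * (pencil A')⁻¹ := by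
          rw [← Matrix.mul_assoc, Matrix.nonsing_inv_mul _ (isUnit_det_pencil A), Matrix.one_mul]
      _ = (pencil A)⁻¹ * P' := by
          rw [h1, Matrix.mul_assoc, Matrix.mul_assoc P',
            Matrix.mul_nonsing_inv _ (isUnit_det_pencil A'), Matrix.mul_one]
  rw [transferFunction, transferFunction, ← hB, ← hC, map_mul_C, map_mul_C, Matrix.mul_assoc,
    Matrix.mul_assoc _ P', h2, Matrix.mul_assoc, Matrix.mul_assoc]

theorem transpose_transferFunction (A : Matrix ι ι ℂ) (B : Matrix ι (Fin n) ℂ)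
    (C : Matrix (Fin n) ι ℂ) :
    (transferFunction A B C).transpose =
      transferFunction A.transpose C.transpose B.transpose := by
  have h : (pencil A).transpose = pencil A.transpose := by
    rw [pencil_eq, pencil_eq, Matrix.transpose_sub]
    simp [Matrix.scalar_apply, Matrix.transpose_map]
  rw [transferFunction, transferFunction, Matrix.transpose_mul, Matrix.transpose_mul,
    Matrix.transpose_nonsing_inv, h, Matrix.mul_assoc]
  rfl

theorem eval₂_C_neg_X (p : ℂ[X]) :
    p.eval₂ (RatFunc.C (K := ℂ)) (-RatFunc.X) = algebraMap ℂ[X] (RatFunc ℂ) (p.comp (-X)) := by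
  rw [Polynomial.comp, Polynomial.hom_eval₂, RatFunc.algebraMap_comp_C]
  simp

/-- The substitution `s ↦ -s` as a ring homomorphism. -/
def reflectHom : RatFunc ℂ →+* RatFunc ℂ :=
  RatFunc.liftRingHom (eval₂RingHom (RatFunc.C (K := ℂ)) (-RatFunc.X)) <| by
    intro p hp
    rw [Submonoid.mem_comap, mem_nonZeroDivisors_iff_ne_zero]
    simp only [coe_eval₂RingHom, eval₂_C_neg_X]
    refine RatFunc.algebraMap_ne_zero fun h => nonZeroDivisors.ne_zero hp ?_
    exact (comp_neg_X_eq_zero_iff).mp h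

theorem reflect_eq (G : TransferFunction n) : reflect G = G.map reflectHom := by
  ext i j
  simp [reflect, reflectHom, RatFunc.liftRingHom_apply, RatFunc.eval]

theorem reflectHom_C (a : ℂ) : reflectHom (RatFunc.C a) = RatFunc.C a := by
  simp [reflectHom, RatFunc.liftRingHom_C]

theorem reflectHom_X : reflectHom RatFunc.X = -RatFunc.X := by
  simp [reflectHom, RatFunc.liftRingHom_X]

theorem map_C_map_reflectHom {l m : Type*} (M : Matrix l m ℂ) :
    (M.map (RatFunc.C (K := ℂ))).map reflectHom = M.map (RatFunc.C (K := ℂ)) := by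
  ext i j
  simp [reflectHom_C]

theorem reflect_transferFunction (A : Matrix ι ι ℂ) (B : Matrix ι (Fin n) ℂ)
    (C : Matrix (Fin n) ι ℂ) :
    reflect (transferFunction A B C) = transferFunction (-A) B (-C) := by
  have hp : (pencil A).map reflectHom = -pencil (-A) := by
    rw [pencil_eq, pencil_eq]
    ext i j
    by_cases hij : i = j
    · subst hij
      simp [reflectHom_C, reflectHom_X]
      ring
    · simp [reflectHom_C, hij]
  have hi : ((pencil A)⁻¹).map reflectHom = -(pencil (-A))⁻¹ := by
    have h1 := congrArg (fun M : Matrix ι ι (RatFunc ℂ) => M.map reflectHom)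
      (Matrix.mul_nonsing_inv _ (isUnit_det_pencil A))
    simp only [Matrix.map_mul, hp] at h1
    rw [Matrix.map_one _ (map_zero _) (map_one _), neg_mul] at h1
    have h2 : (pencil (-A))⁻¹ * (pencil (-A) * ((pencil A)⁻¹).map reflectHom) =
        ((pencil A)⁻¹).map reflectHom := by
      rw [← mul_assoc, Matrix.nonsing_inv_mul _ (isUnit_det_pencil (-A)), one_mul]
    rw [← h2, neg_eq_iff_eq_neg.mp h1, mul_neg, mul_one]
  rw [reflect_eq, transferFunction, transferFunction, Matrix.map_mul, Matrix.map_mul,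
    map_C_map_reflectHom, map_C_map_reflectHom, hi]
  rw [Matrix.map_neg _ (map_neg _)]
  simp

/-- With Φ, Ψ the open and closed loop resolvents, Ψ − Φ(BFC)Ψ = Φ. Multiplied by C and B this reads
(1 − GF)·CΨB = G. It also yields the right inverse 1 + CΨBF of 1 − GF, so that factor can be
cancelled. -/
theorem closedLoop_transferFunction (A : Matrix ι ι ℂ) (B : Matrix ι (Fin n) ℂ)
    (C : Matrix (Fin n) ι ℂ) (F : Matrix (Fin n) (Fin n) ℂ) :
    closedLoop (transferFunction A B C) F = transferFunction (A + B * F * C) B C := by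
  set B' := B.map (RatFunc.C (K := ℂ)) with hB
  set C' := C.map (RatFunc.C (K := ℂ)) with hC
  set F' := F.map (RatFunc.C (K := ℂ)) with hF
  set Φ := (pencil A)⁻¹ with hΦ
  set Ψ := (pencil (A + B * F * C))⁻¹ with hΨ
  have hp : pencil (A + B * F * C) = pencil A - B' * F' * C' := by
    rw [pencil_eq, pencil_eq, Matrix.map_add _ (map_add _), map_mul_C, map_mul_C, sub_sub]
  have h1 : Ψ - Φ * (B' * F' * C') * Ψ = Φ := by
    calc Ψ - Φ * (B' * F' * C') * Ψ = Φ * (pencil A - B' * F' * C') * Ψ := by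
          rw [mul_sub, sub_mul, Matrix.nonsing_inv_mul _ (isUnit_det_pencil A), one_mul]
      _ = Φ := by
          rw [← hp, Matrix.mul_assoc, Matrix.mul_nonsing_inv _ (isUnit_det_pencil _), mul_one]
  have h2 : (1 - C' * Φ * B' * F') * (C' * Ψ * B') = C' * Φ * B' := by
    conv_rhs => rw [← h1]
    simp only [Matrix.sub_mul, Matrix.mul_sub, Matrix.one_mul, Matrix.mul_assoc]
  have h3 : (1 - C' * Φ * B' * F') * (1 + C' * Ψ * B' * F') = 1 := by
    have : (1 - C' * Φ * B' * F') * (C' * Ψ * B' * F') = C' * Φ * B' * F' := by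
      rw [← Matrix.mul_assoc, h2]
    rw [mul_add, this, mul_one, sub_add_cancel]
  have h4 : IsUnit (1 - C' * Φ * B' * F').det := Matrix.isUnit_det_of_right_inverse h3
  calc closedLoop (transferFunction A B C) F
      = (1 - C' * Φ * B' * F')⁻¹ * ((1 - C' * Φ * B' * F') * (C' * Ψ * B')) := by rw [h2]; rfl
    _ = C' * Ψ * B' := by rw [← mul_assoc, Matrix.nonsing_inv_mul _ h4, one_mul]

/-- The numerator matrix of `C (s I - A)⁻¹ B` over the denominator `det (s I - A)`. -/
def numerator (A : Matrix ι ι ℂ) (B : Matrix ι (Fin n) ℂ) (C : Matrix (Fin n) ι ℂ) :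
    Matrix (Fin n) (Fin n) ℂ[X] :=
  C.map Polynomial.C * A.charmatrix.adjugate * B.map Polynomial.C

theorem transferFunction_apply (A : Matrix ι ι ℂ) (B : Matrix ι (Fin n) ℂ)
    (C : Matrix (Fin n) ι ℂ) (i j : Fin n) :
    transferFunction A B C i j =
      algebraMap ℂ[X] (RatFunc ℂ) (numerator A B C i j) /
        algebraMap ℂ[X] (RatFunc ℂ) A.charpoly := by
  have h1 : (pencil A)⁻¹ = (algebraMap ℂ[X] (RatFunc ℂ) A.charpoly)⁻¹ •
      A.charmatrix.adjugate.map (algebraMap ℂ[X] (RatFunc ℂ)) := by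
    rw [Matrix.inv_def, det_pencil, Ring.inverse_eq_inv']
    congr 1
    exact ((algebraMap ℂ[X] (RatFunc ℂ)).map_adjugate A.charmatrix).symm
  have h2 : (numerator A B C).map (algebraMap ℂ[X] (RatFunc ℂ)) =
      C.map (RatFunc.C (K := ℂ)) * A.charmatrix.adjugate.map (algebraMap ℂ[X] (RatFunc ℂ)) *
        B.map (RatFunc.C (K := ℂ)) := by
    rw [numerator, Matrix.map_mul, Matrix.map_mul, Matrix.map_map, Matrix.map_map]
    congr 2
  rw [transferFunction, h1, Matrix.mul_smul, Matrix.smul_mul, ← h2, Matrix.smul_apply,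
    Matrix.map_apply, smul_eq_mul, div_eq_inv_mul]

/-- Read as a polynomial with matrix coefficients, the adjugate N satisfies (X − A)N = charpoly(A).
Since X − A is monic of degree one, N has degree one less than the characteristic polynomial. -/
theorem degree_adjugate_charmatrix_lt (A : Matrix ι ι ℂ) (i j : ι) :
    (A.charmatrix.adjugate i j).degree < A.charpoly.degree := by
  rw [A.charpoly_degree_eq_dim]
  have : Nonempty ι := ⟨i⟩
  have h1 := congrArg matPolyEquiv A.charmatrix.mul_adjugate
  rw [map_mul, Matrix.matPolyEquiv_charmatrix] at h1
  have h2 : matPolyEquiv (A.charmatrix.det • (1 : Matrix ι ι ℂ[X])) =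
      A.charpoly.map (algebraMap ℂ (Matrix ι ι ℂ)) := by
    rw [matPolyEquiv_smul_one]; rfl
  rw [h2] at h1
  have h3 : matPolyEquiv A.charmatrix.adjugate ≠ 0 := by
    intro h0
    rw [h0, mul_zero] at h1
    exact (A.charpoly_monic.map (algebraMap ℂ (Matrix ι ι ℂ))).ne_zero h1.symm
  have h4 := congrArg natDegree h1
  rw [(monic_X_sub_C A).natDegree_mul' h3, natDegree_X_sub_C, A.charpoly_monic.natDegree_map,
    A.charpoly_natDegree_eq_dim] at h4
  rw [degree_lt_iff_coeff_zero]
  intro k hk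
  rw [← matPolyEquiv_coeff_apply, coeff_eq_zero_of_natDegree_lt (by omega), Matrix.zero_apply]

theorem degree_numerator_lt (A : Matrix ι ι ℂ) (B : Matrix ι (Fin n) ℂ)
    (C : Matrix (Fin n) ι ℂ) (i j : Fin n) :
    (numerator A B C i j).degree < A.charpoly.degree := by
  have h : A.charpoly.degree = (Fintype.card ι : ℕ) := A.charpoly_degree_eq_dim
  rw [h, ← mem_degreeLT, numerator]
  simp only [Matrix.mul_apply, Matrix.map_apply]
  refine Submodule.sum_mem _ fun b _ => ?_
  rw [mul_comm, ← smul_eq_C_mul]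
  refine Submodule.smul_mem _ _ (Submodule.sum_mem _ fun a _ => ?_)
  rw [← smul_eq_C_mul]
  refine Submodule.smul_mem _ _ ?_
  rw [mem_degreeLT, ← h]
  exact degree_adjugate_charmatrix_lt A a b

theorem num_mul_eq_mul_denom {f : RatFunc ℂ} {p q : ℂ[X]} (hq : q ≠ 0)
    (hf : f = algebraMap ℂ[X] (RatFunc ℂ) p / algebraMap ℂ[X] (RatFunc ℂ) q) :
    f.num * q = p * f.denom :=
  (RatFunc.num_mul_eq_mul_denom_iff hq).mpr hf

theorem degree_num_lt_degree_denom {f : RatFunc ℂ} {p q : ℂ[X]} (hpq : p.degree < q.degree)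
    (hf : f = algebraMap ℂ[X] (RatFunc ℂ) p / algebraMap ℂ[X] (RatFunc ℂ) q) :
    f.num.degree < f.denom.degree := by
  have hq : q ≠ 0 := fun h => by simp [h] at hpq
  have h := congrArg degree (num_mul_eq_mul_denom hq hf)
  rw [degree_mul, degree_mul] at h
  by_contra! hle
  have h1 : p.degree + f.denom.degree < q.degree + f.denom.degree :=
    WithBot.add_lt_add_right (degree_ne_bot.mpr f.denom_ne_zero) hpq
  rw [← h, add_comm q.degree] at h1
  exact absurd (add_le_add_left hle q.degree) (not_le.mpr h1)

/-- A common monic factor of numerator and denominator multiplies the remainder and leaves the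
quotient unchanged. So Markov parameters can be read from an unreduced fraction. -/
theorem markovParameter_eq {f : RatFunc ℂ} {p q : ℂ[X]} (hq : q.Monic)
    (hf : f = algebraMap ℂ[X] (RatFunc ℂ) p / algebraMap ℂ[X] (RatFunc ℂ) q) (k : ℕ) :
    markovParameter f k = ((p * X ^ (k + 1)) /ₘ q).coeff 0 := by
  obtain ⟨g, hg⟩ : f.denom ∣ q := hf ▸ RatFunc.denom_div_dvd p q
  have hgm : g.Monic := f.monic_denom.of_mul_monic_left (hg ▸ hq)
  have hp : p = f.num * g := by
    have h := num_mul_eq_mul_denom hq.ne_zero hf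
    rw [hg, mul_left_comm, mul_comm p] at h
    exact (mul_left_cancel₀ f.denom_ne_zero h).symm
  have h := div_modByMonic_unique (f := p * X ^ (k + 1)) (g := q)
    (f.num * X ^ (k + 1) /ₘ f.denom) (f.num * X ^ (k + 1) %ₘ f.denom * g) hq ⟨?_, ?_⟩
  · rw [h.1, markovParameter]
  · conv_rhs => rw [hp, mul_right_comm, ← modByMonic_add_div (f.num * X ^ (k + 1)) f.denom]
    rw [hg]
    ring
  · rw [hg, degree_mul, degree_mul]
    exact WithBot.add_lt_add_right (degree_ne_bot.mpr hgm.ne_zero)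
      (degree_modByMonic_lt _ f.monic_denom)

theorem strictlyProper_transferFunction (A : Matrix ι ι ℂ) (B : Matrix ι (Fin n) ℂ)
    (C : Matrix (Fin n) ι ℂ) : StrictlyProper (transferFunction A B C) := fun i j =>
  degree_num_lt_degree_denom (degree_numerator_lt A B C i j) (transferFunction_apply A B C i j)

theorem map_C_pow (A : Matrix ι ι ℂ) (k : ℕ) :
    (A ^ k).map Polynomial.C = A.map Polynomial.C ^ k :=
  map_pow (Polynomial.C : ℂ →+* ℂ[X]).mapMatrix A k

/-- Multiply the geometric sum identity sᵏ − Aᵏ = (s − A) ∑ sⁱ Aᵏ⁻¹⁻ⁱ by the adjugate of s − A. -/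
theorem X_pow_smul_adjugate_charmatrix (A : Matrix ι ι ℂ) (k : ℕ) :
    (X ^ k : ℂ[X]) • A.charmatrix.adjugate =
      A.charpoly • ∑ i ∈ Finset.range k, (X ^ i : ℂ[X]) • (A ^ (k - 1 - i)).map Polynomial.C +
      A.charmatrix.adjugate * (A ^ k).map Polynomial.C := by
  have hX (i : ℕ) (M : Matrix ι ι ℂ[X]) :
      Matrix.scalar ι (X : ℂ[X]) ^ i * M = (X ^ i : ℂ[X]) • M := by
    rw [← map_pow]
    exact (Matrix.smul_eq_diagonal_mul _ _).symm
  have hcomm : Commute (Matrix.scalar ι (X : ℂ[X])) (A.map Polynomial.C) :=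
    Matrix.scalar_commute _ (fun r => Commute.all _ _) _
  have hcomm' : Commute (Matrix.scalar ι (X : ℂ[X])) A.charmatrix.adjugate :=
    Matrix.scalar_commute _ (fun r => Commute.all _ _) _
  have h1 := hcomm.mul_geom_sum₂ k
  have h2 : Matrix.scalar ι (X : ℂ[X]) - A.map Polynomial.C = A.charmatrix := rfl
  rw [h2] at h1
  have h3 := congrArg (A.charmatrix.adjugate * ·) h1
  simp only [← mul_assoc, Matrix.adjugate_mul, mul_sub] at h3
  rw [← (hcomm'.pow_left k).eq, hX, Matrix.smul_mul, Matrix.one_mul] at h3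
  simp only [hX, ← map_C_pow] at h3
  exact (eq_sub_iff_add_eq.mp h3).symm

/-- This is division with remainder by the characteristic polynomial: the last summand is the
numerator of the system (A, AᵏB, C), so `degree_numerator_lt` bounds it. -/
theorem X_pow_smul_numerator (A : Matrix ι ι ℂ) (B : Matrix ι (Fin n) ℂ)
    (C : Matrix (Fin n) ι ℂ) (k : ℕ) :
    (X ^ k : ℂ[X]) • numerator A B C =
      A.charpoly • ∑ i ∈ Finset.range k, (X ^ i : ℂ[X]) •
        (C * A ^ (k - 1 - i) * B).map Polynomial.C +
      numerator A (A ^ k * B) C := by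
  simp only [numerator, Matrix.map_mul]
  rw [← Matrix.smul_mul, ← Matrix.mul_smul, X_pow_smul_adjugate_charmatrix, Matrix.mul_add,
    Matrix.add_mul, Matrix.mul_smul, Matrix.smul_mul, Matrix.mul_sum, Matrix.sum_mul]
  simp only [Matrix.mul_smul, Matrix.smul_mul, Matrix.mul_assoc]

theorem coeff_zero_numerator_mul_X_pow_divByMonic (A : Matrix ι ι ℂ) (B : Matrix ι (Fin n) ℂ)
    (C : Matrix (Fin n) ι ℂ) (i j : Fin n) (k : ℕ) :
    (numerator A B C i j * X ^ (k + 1) /ₘ A.charpoly).coeff 0 = (C * A ^ k * B) i j := by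
  have h := congrFun (congrFun (X_pow_smul_numerator A B C (k + 1)) i) j
  set S := ∑ i ∈ Finset.range (k + 1), (X ^ i : ℂ[X]) •
        (C * A ^ (k + 1 - 1 - i) * B).map Polynomial.C with hS
  rw [Matrix.add_apply, Matrix.smul_apply, Matrix.smul_apply, smul_eq_mul, smul_eq_mul,
    mul_comm, add_comm (A.charpoly * _)] at h
  have h' : numerator A B C i j * X ^ (k + 1) /ₘ A.charpoly = S i j :=
    (div_modByMonic_unique (S i j) (numerator A (A ^ (k + 1) * B) C i j) A.charpoly_monic
      ⟨h.symm, degree_numerator_lt _ _ _ i j⟩).1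
  rw [h', hS, Matrix.sum_apply, finsetSum_coeff, Finset.sum_eq_single 0]
  · simp [-Matrix.map_mul]
  · intro l _ hl
    simp [mul_coeff_zero, hl.symm]
  · simp

theorem markovParameter_transferFunction (A : Matrix ι ι ℂ) (B : Matrix ι (Fin n) ℂ)
    (C : Matrix (Fin n) ι ℂ) (i j : Fin n) (k : ℕ) :
    markovParameter (transferFunction A B C i j) k = (C * A ^ k * B) i j := by
  rw [markovParameter_eq A.charpoly_monic (transferFunction_apply A B C i j),
    coeff_zero_numerator_mul_X_pow_divByMonic]

end Resolvent

/-! ### Minimal realizations, their uniqueness, and self-duality -/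

section Realization

variable {n d : ℕ}

/-- The sequence of outputs `C A ^ k v` of the state `v`. -/
def observation (A : Matrix (Fin d) (Fin d) ℂ) (C : Matrix (Fin n) (Fin d) ℂ) :
    (Fin d → ℂ) →ₗ[ℂ] (ℕ → Fin n → ℂ) :=
  LinearMap.pi fun k => (C * A ^ k).mulVecLin

/-- The state `∑ A ^ k B u_k` reached by a finite sequence `u` of inputs. -/
def reach (A : Matrix (Fin d) (Fin d) ℂ) (B : Matrix (Fin d) (Fin n) ℂ) :
    (ℕ →₀ (Fin n → ℂ)) →ₗ[ℂ] (Fin d → ℂ) :=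
  Finsupp.lsum ℂ fun k => (A ^ k * B).mulVecLin

theorem observation_apply (A : Matrix (Fin d) (Fin d) ℂ) (C : Matrix (Fin n) (Fin d) ℂ)
    (v : Fin d → ℂ) (k : ℕ) : observation A C v k = (C * A ^ k).mulVec v := rfl

theorem reach_single (A : Matrix (Fin d) (Fin d) ℂ) (B : Matrix (Fin d) (Fin n) ℂ)
    (k : ℕ) (u : Fin n → ℂ) : reach A B (Finsupp.single k u) = (A ^ k * B).mulVec u := by
  simp [reach]

theorem observation_mulVec (A : Matrix (Fin d) (Fin d) ℂ) (C : Matrix (Fin n) (Fin d) ℂ)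
    (v : Fin d → ℂ) (k : ℕ) : observation A C (A.mulVec v) k = observation A C v (k + 1) := by
  rw [observation_apply, observation_apply, Matrix.mulVec_mulVec, pow_succ, Matrix.mul_assoc]

theorem toMatrix_toLin'_basisFun {l m : Type*} [Fintype l] [Fintype m] [DecidableEq l]
    [DecidableEq m] (M : Matrix l m ℂ) :
    LinearMap.toMatrix (Pi.basisFun ℂ m) (Pi.basisFun ℂ l) (Matrix.toLin' M) = M := by
  ext i j
  simp [LinearMap.toMatrix_apply]

/-- A minimal realization is observable. -/
theorem observation_injective {G : TransferFunction n} (hG : HasMcMillanDegree G d)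
    {A : Matrix (Fin d) (Fin d) ℂ} {B : Matrix (Fin d) (Fin n) ℂ} {C : Matrix (Fin n) (Fin d) ℂ}
    (h : G = transferFunction A B C) : Function.Injective (observation A C) := by
  rw [← LinearMap.ker_eq_bot]
  set W := LinearMap.ker (observation A C) with hW
  by_contra hne
  have hA : W ≤ W.comap (Matrix.toLin' A) := by
    intro v hv
    rw [Submodule.mem_comap, hW, LinearMap.mem_ker, Matrix.toLin'_apply]
    funext k
    rw [observation_mulVec, LinearMap.mem_ker.mp hv]
    rfl
  have hC : W ≤ LinearMap.ker (Matrix.toLin' C) := by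
    intro v hv
    have := congrFun (LinearMap.mem_ker.mp hv) 0
    rw [observation_apply, pow_zero, Matrix.mul_one] at this
    exact this
  let b := Module.finBasis ℂ ((Fin d → ℂ) ⧸ W)
  let e := Pi.basisFun ℂ (Fin d)
  let P := LinearMap.toMatrix e b W.mkQ
  -- The system descends to the quotient by the unobservable subspace W, which would give a
  -- realization of smaller dimension.
  have h1 : transferFunction (LinearMap.toMatrix b b (W.mapQ W (Matrix.toLin' A) hA)) (P * B)
      (LinearMap.toMatrix b (Pi.basisFun ℂ (Fin n)) (W.liftQ (Matrix.toLin' C) hC)) =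
      transferFunction A B C := by
    refine transferFunction_eq_of_intertwining P ?_ rfl ?_
    · conv_rhs => rw [← toMatrix_toLin'_basisFun A]
      rw [← LinearMap.toMatrix_comp, ← LinearMap.toMatrix_comp, Submodule.mapQ_mkQ]
    · conv_rhs => rw [← toMatrix_toLin'_basisFun C]
      rw [← LinearMap.toMatrix_comp, Submodule.liftQ_mkQ]
  have h2 := hG.2 ⟨_, _, _, isRealization_iff.mpr (h.trans h1.symm)⟩
  have h3 := W.finrank_quotient_add_finrank
  rw [Module.finrank_fin_fun] at h3
  have h4 : 0 < Module.finrank ℂ W :=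
    Module.finrank_pos_iff.mpr (Submodule.nontrivial_iff_ne_bot.mpr hne)
  omega

/-- A minimal realization is controllable. -/
theorem reach_surjective {G : TransferFunction n} (hG : HasMcMillanDegree G d)
    {A : Matrix (Fin d) (Fin d) ℂ} {B : Matrix (Fin d) (Fin n) ℂ} {C : Matrix (Fin n) (Fin d) ℂ}
    (h : G = transferFunction A B C) : Function.Surjective (reach A B) := by
  rw [← LinearMap.range_eq_top]
  set W := LinearMap.range (reach A B) with hW
  by_contra hne
  have hA : ∀ v ∈ W, Matrix.toLin' A v ∈ W := by
    rintro _ ⟨u, rfl⟩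
    induction u using Finsupp.induction_linear with
    | zero => simp
    | add f g hf hg => rw [map_add, map_add]; exact add_mem hf hg
    | single k u =>
      refine ⟨Finsupp.single (k + 1) u, ?_⟩
      rw [reach_single, reach_single, Matrix.toLin'_apply, Matrix.mulVec_mulVec, pow_succ',
        Matrix.mul_assoc]
  have hB : ∀ u, Matrix.toLin' B u ∈ W := fun u => ⟨Finsupp.single 0 u, by simp [reach_single]⟩
  let b := Module.finBasis ℂ W
  let e := Pi.basisFun ℂ (Fin d)
  let P := LinearMap.toMatrix b e W.subtype
  -- The system restricts to the reachable subspace W, which would give a realization of smaller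
  -- dimension.
  have h1 : transferFunction A B C =
      transferFunction (LinearMap.toMatrix b b ((Matrix.toLin' A).restrict hA))
      (LinearMap.toMatrix (Pi.basisFun ℂ (Fin n)) b ((Matrix.toLin' B).codRestrict W hB))
      (C * P) := by
    refine transferFunction_eq_of_intertwining P ?_ ?_ rfl
    · conv_lhs => rw [← toMatrix_toLin'_basisFun A]
      rw [← LinearMap.toMatrix_comp, ← LinearMap.toMatrix_comp]
      rfl
    · conv_rhs => rw [← toMatrix_toLin'_basisFun B]
      rw [← LinearMap.toMatrix_comp, LinearMap.subtype_comp_codRestrict]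
  have h2 := hG.2 ⟨_, _, _, isRealization_iff.mpr (h.trans h1)⟩
  have h3 := Submodule.finrank_lt hne
  rw [Module.finrank_fin_fun] at h3
  omega

/-- Two minimal realizations of the same transfer function are similar. -/
theorem exists_similarity {G : TransferFunction n} (hG : HasMcMillanDegree G d)
    {A A' : Matrix (Fin d) (Fin d) ℂ} {B B' : Matrix (Fin d) (Fin n) ℂ}
    {C C' : Matrix (Fin n) (Fin d) ℂ} (h : G = transferFunction A B C)
    (h' : G = transferFunction A' B' C') :
    ∃ S : Matrix (Fin d) (Fin d) ℂ, IsUnit S ∧ A * S = S * A' ∧ S * B' = B ∧ C * S = C' := by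
  have hO := observation_injective hG h
  have hR := reach_surjective hG h
  have hR' := reach_surjective hG h'
  -- The two Hankel maps agree, since their blocks are the Markov parameters C Aᵏ⁺ʲ B of the common
  -- transfer function.
  have hOR : observation A C ∘ₗ reach A B = observation A' C' ∘ₗ reach A' B' := by
    refine Finsupp.lhom_ext fun j u => ?_
    funext k
    rw [LinearMap.comp_apply, LinearMap.comp_apply, reach_single, reach_single,
      observation_apply, observation_apply, Matrix.mulVec_mulVec, Matrix.mulVec_mulVec]
    congr 1
    have hm : C * A ^ (k + j) * B = C' * A' ^ (k + j) * B' := by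
      ext a b
      rw [← markovParameter_transferFunction, ← markovParameter_transferFunction, ← h, ← h']
    rw [pow_add, pow_add] at hm
    simpa only [Matrix.mul_assoc] using hm
  obtain ⟨L, hL⟩ := LinearMap.exists_leftInverse_of_injective _ (LinearMap.ker_eq_bot.mpr hO)
  -- The map s sends the state reached by inputs u in the second system to the state reached by the
  -- same inputs in the first.
  set s : (Fin d → ℂ) →ₗ[ℂ] (Fin d → ℂ) := L ∘ₗ observation A' C' with hs
  have hsR (u) : s (reach A' B' u) = reach A B u := by
    have h1 := congrArg L (LinearMap.congr_fun hOR u)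
    rw [LinearMap.comp_apply, LinearMap.comp_apply] at h1
    exact h1.symm.trans (LinearMap.congr_fun hL _)
  have hOs (v) : observation A C (s v) = observation A' C' v := by
    obtain ⟨u, rfl⟩ := hR' v
    rw [hsR]
    exact LinearMap.congr_fun hOR u
  have hsurj : Function.Surjective s := fun v => by
    obtain ⟨u, rfl⟩ := hR v
    exact ⟨_, hsR u⟩
  have hmul (v) : (LinearMap.toMatrix' s).mulVec v = s v := LinearMap.toMatrix'_mulVec s v
  refine ⟨LinearMap.toMatrix' s, ?_, ?_, ?_, ?_⟩
  · rw [← Matrix.mulVec_surjective_iff_isUnit]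
    intro v
    obtain ⟨u, rfl⟩ := hsurj v
    exact ⟨u, hmul u⟩
  · refine Matrix.ext_of_mulVec_single fun i => ?_
    rw [← Matrix.mulVec_mulVec, ← Matrix.mulVec_mulVec, hmul, hmul]
    apply hO
    funext k
    rw [observation_mulVec, hOs, hOs, observation_mulVec]
  · refine Matrix.ext_of_mulVec_single fun i => ?_
    have := hsR (Finsupp.single 0 (Pi.single i 1))
    rw [← Matrix.mulVec_mulVec, hmul]
    simpa [reach_single] using this
  · refine Matrix.ext_of_mulVec_single fun i => ?_
    have := congrFun (hOs (Pi.single i 1)) 0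
    rw [← Matrix.mulVec_mulVec, hmul]
    simpa [observation_apply] using this

/-- The similarity between two minimal realizations is unique. -/
theorem similarity_unique {G : TransferFunction n} (hG : HasMcMillanDegree G d)
    {A A' : Matrix (Fin d) (Fin d) ℂ} {B B' : Matrix (Fin d) (Fin n) ℂ}
    {C' : Matrix (Fin n) (Fin d) ℂ}
    (h' : G = transferFunction A' B' C') {S T : Matrix (Fin d) (Fin d) ℂ}
    (hS : A * S = S * A') (hSB : S * B' = B) (hT : A * T = T * A') (hTB : T * B' = B) : S = T := by
  have hpow {S : Matrix (Fin d) (Fin d) ℂ} (hS : A * S = S * A') (k : ℕ) :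
      A ^ k * S = S * A' ^ k := by
    induction k with
    | zero => simp
    | succ k ih => rw [pow_succ, pow_succ', mul_assoc, hS, ← mul_assoc, ih, mul_assoc, ← pow_succ,
        ← pow_succ']
  have key (v : Fin d → ℂ) : S.mulVec v = T.mulVec v := by
    obtain ⟨u, rfl⟩ := reach_surjective hG h' v
    induction u using Finsupp.induction_linear with
    | zero => simp
    | add f g hf hg => rw [map_add, Matrix.mulVec_add, Matrix.mulVec_add, hf, hg]
    | single k u =>
      rw [reach_single, Matrix.mulVec_mulVec, Matrix.mulVec_mulVec, ← Matrix.mul_assoc,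
        ← Matrix.mul_assoc, ← hpow hS, ← hpow hT, Matrix.mul_assoc, Matrix.mul_assoc, hSB, hTB]
  exact Matrix.ext_of_mulVec_single fun i => key _

theorem HasMcMillanDegree.unique {G : TransferFunction n} {d d' : ℕ} (h : HasMcMillanDegree G d)
    (h' : HasMcMillanDegree G d') : d = d' :=
  IsLeast.unique h h'

theorem closedLoop_closedLoop_neg {G : TransferFunction n}
    {A : Matrix (Fin d) (Fin d) ℂ} {B : Matrix (Fin d) (Fin n) ℂ} {C : Matrix (Fin n) (Fin d) ℂ}
    (h : G = transferFunction A B C) (F : Matrix (Fin n) (Fin n) ℂ) :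
    closedLoop (closedLoop G F) (-F) = G := by
  rw [h, closedLoop_transferFunction, closedLoop_transferFunction]
  congr 1
  simp

/-- Output feedback preserves the McMillan degree. -/
theorem HasMcMillanDegree.closedLoop {G : TransferFunction n} (hG : HasMcMillanDegree G d)
    (F : Matrix (Fin n) (Fin n) ℂ) : HasMcMillanDegree (closedLoop G F) d := by
  obtain ⟨⟨A, B, C, h⟩, hmin⟩ := hG
  rw [isRealization_iff] at h
  refine ⟨⟨A + B * F * C, B, C, ?_⟩, ?_⟩
  · rw [isRealization_iff, h, closedLoop_transferFunction]
  -- Feedback −F turns a realization of the closed loop into one of G of the same dimension.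
  · rintro d' ⟨A', B', C', h'⟩
    refine hmin ⟨A' + B' * -F * C', B', C', ?_⟩
    rw [isRealization_iff] at h' ⊢
    rw [← closedLoop_closedLoop_neg h F, h', closedLoop_transferFunction]

theorem charpoly_eq_of_isRealization {G : TransferFunction n} (hG : HasMcMillanDegree G d)
    {A A' : Matrix (Fin d) (Fin d) ℂ} {B B' : Matrix (Fin d) (Fin n) ℂ}
    {C C' : Matrix (Fin n) (Fin d) ℂ} (h : G = transferFunction A B C)
    (h' : G = transferFunction A' B' C') : A.charpoly = A'.charpoly := by
  obtain ⟨S, hS, hA, -⟩ := exists_similarity hG h h'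
  obtain ⟨u, rfl⟩ := hS
  have : A = u.val * A' * u⁻¹.val := by
    rw [← hA, mul_assoc, Units.mul_inv, mul_one]
  rw [this, Matrix.coe_units_inv, Matrix.charpoly_units_conj]

/-- The closed loop characteristic polynomial in terms of a minimal realization. -/
theorem hasCharacteristicPolynomial_closedLoop_iff {G : TransferFunction n}
    (hG : HasMcMillanDegree G d) {A : Matrix (Fin d) (Fin d) ℂ} {B : Matrix (Fin d) (Fin n) ℂ}
    {C : Matrix (Fin n) (Fin d) ℂ} (h : G = transferFunction A B C)
    (F : Matrix (Fin n) (Fin n) ℂ) (φ : ℂ[X]) :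
    HasCharacteristicPolynomial (closedLoop G F) φ ↔ (A + B * F * C).charpoly = φ := by
  have hF : closedLoop G F = transferFunction (A + B * F * C) B C := by
    rw [h, closedLoop_transferFunction]
  constructor
  · rintro ⟨d', A', B', C', hd', h', rfl⟩
    obtain rfl := hd'.unique (hG.closedLoop F)
    exact charpoly_eq_of_isRealization hd' hF h'
  · exact fun hφ => ⟨d, _, B, C, hG.closedLoop F, hF, hφ⟩

/-- The sign `ε` in `G(ε s)ᵗ = G(s)`: `1` for symmetric, `-1` for Hamiltonian (`h = true`). -/
def sign (h : Bool) : ℂ := cond h (-1) 1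

/-- `G(s)ᵗ` in the symmetric, `G(-s)ᵗ` in the Hamiltonian case (`h = true`). -/
def dual (h : Bool) (G : TransferFunction n) : TransferFunction n :=
  cond h (reflect G).transpose G.transpose

theorem sign_mul_sign (h : Bool) : sign h * sign h = 1 := by cases h <;> simp [sign]

theorem dual_transferFunction {ι : Type*} [Fintype ι] [DecidableEq ι] (h : Bool)
    (A : Matrix ι ι ℂ) (B : Matrix ι (Fin n) ℂ) (C : Matrix (Fin n) ι ℂ) :
    dual h (transferFunction A B C) =
      transferFunction (sign h • A.transpose) C.transpose (sign h • B.transpose) := by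
  cases h
  · simp [dual, sign, transpose_transferFunction]
  -- The intertwiner −1 moves the minus sign from the input to the output matrix.
  · have h1 := transferFunction_eq_of_intertwining (A := -A.transpose) (B := -C.transpose)
      (C := B.transpose) (A' := -A.transpose) (B' := C.transpose) (C' := -B.transpose) (-1)
      (by simp) (by simp) (by simp)
    simp [dual, sign, reflect_transferFunction, transpose_transferFunction, h1]

/-- A self-dual system: `A = S K` with `K` symmetric and `S` symmetric or skew-symmetric. -/
theorem dual_transferFunction_eq_self {ι : Type*} [Fintype ι] [DecidableEq ι] (h : Bool)
    {S K : Matrix ι ι ℂ} (C : Matrix (Fin n) ι ℂ) (hS : S.transpose = sign h • S)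
    (hK : K.transpose = K) :
    dual h (transferFunction (S * K) (S * C.transpose) C) =
      transferFunction (S * K) (S * C.transpose) C := by
  rw [dual_transferFunction]
  symm
  refine transferFunction_eq_of_intertwining S ?_ rfl ?_
  · simp only [Matrix.transpose_mul, hS, hK, Matrix.mul_smul, smul_smul, sign_mul_sign, one_smul,
      Matrix.mul_assoc]
  · rw [Matrix.transpose_mul, Matrix.transpose_transpose, hS, Matrix.mul_smul, smul_smul,
      sign_mul_sign, one_smul]

/-- Minimal realizations of self-dual transfer functions can be chosen self-dual. -/
theorem exists_selfDual_realization (h : Bool) {G : TransferFunction n}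
    (hG : HasMcMillanDegree G d) (hdual : dual h G = G) :
    ∃ (S K : Matrix (Fin d) (Fin d) ℂ) (C : Matrix (Fin n) (Fin d) ℂ),
      S.transpose = sign h • S ∧ K.transpose = K ∧ IsUnit S ∧
        G = transferFunction (S * K) (S * C.transpose) C := by
  obtain ⟨A, B, C, hr⟩ := hG.1
  rw [isRealization_iff] at hr
  have hr' := hdual.symm
  conv_rhs at hr' => rw [hr]
  rw [dual_transferFunction] at hr'
  obtain ⟨S, hSu, hA, hB, hC⟩ := exists_similarity hG hr hr'
  -- Transposing the similarity relations shows that `sign h • Sᵗ` is a similarity between the same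
  -- two realizations, so uniqueness applies.
  have hST : S = sign h • S.transpose := by
    refine similarity_unique hG hr' hA hB ?_ ?_
    · have := congrArg Matrix.transpose hA
      simp only [Matrix.transpose_mul, Matrix.transpose_smul, Matrix.transpose_transpose,
        Matrix.smul_mul] at this
      simp only [Matrix.mul_smul, Matrix.smul_mul, ← this, smul_smul, sign_mul_sign, one_smul]
    · have := congrArg Matrix.transpose hC
      simp only [Matrix.transpose_mul, Matrix.transpose_smul, Matrix.transpose_transpose] at this
      rw [Matrix.smul_mul, this, smul_smul, sign_mul_sign, one_smul]
  have hS' : S.transpose = sign h • S := by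
    conv_rhs => rw [hST]
    rw [smul_smul, sign_mul_sign, one_smul]
  have hdet := (Matrix.isUnit_iff_isUnit_det S).mp hSu
  have hSK : S * (S⁻¹ * A) = A := by rw [← mul_assoc, Matrix.mul_nonsing_inv _ hdet, one_mul]
  refine ⟨S, S⁻¹ * A, C, hS', ?_, hSu, by rw [hSK, hB]; exact hr⟩
  -- Take K = S⁻¹A and ε = `sign h`. The similarity gives KS = εAᵗ, and transposing SK = A gives Aᵗ
  -- = εKᵗS. Cancelling S yields K = Kᵗ.
  have h1 : (S⁻¹ * A) * S = sign h • A.transpose := by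
    rw [mul_assoc, hA, ← mul_assoc, Matrix.nonsing_inv_mul _ hdet, one_mul]
  have h2 := congrArg Matrix.transpose hSK
  rw [Matrix.transpose_mul, hS', Matrix.mul_smul] at h2
  rw [← h2, smul_smul, sign_mul_sign, one_smul] at h1
  exact (hSu.mul_left_inj.mp h1).symm

/-- Hamiltonian transfer functions have even McMillan degree. -/
theorem even_of_hamiltonian {G : TransferFunction n} (hG : HasMcMillanDegree G d)
    (hdual : dual true G = G) : Even d := by
  obtain ⟨S, K, C, hS, -, hSu, -⟩ := exists_selfDual_realization true hG hdual
  have h1 := congrArg Matrix.det hS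
  rw [Matrix.det_transpose, Matrix.det_smul, Fintype.card_fin] at h1
  have h2 := ((Matrix.isUnit_iff_isUnit_det S).mp hSu).ne_zero
  have h3 : (-1 : ℂ) ^ d = 1 := mul_right_cancel₀ h2 (by rw [one_mul]; exact h1.symm)
  exact (neg_one_pow_eq_one_iff_even (by norm_num)).mp h3

end Realization

/-! ### Admissible polynomials as polynomials in s or s² -/

section Admissible

/-- Admissible polynomials are polynomials in `s ^ stride h`. -/
def stride (h : Bool) : ℕ := cond h 2 1

theorem stride_pos (h : Bool) : 0 < stride h := by cases h <;> simp [stride]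

/-- The admissible polynomials of degree `δ`, in the Hamiltonian case if `h = true`. -/
def admissiblePolynomials (h : Bool) (δ : ℕ) : Set ℂ[X] :=
  cond h (evenMonicPolynomials δ) (monicPolynomials δ)

theorem coeff_comp_neg_X (p : ℂ[X]) (k : ℕ) : (p.comp (-X)).coeff k = (-1) ^ k * p.coeff k := by
  have h : (-X : ℂ[X]) = C (-1) * X := by simp
  rw [h, comp_C_mul_X_coeff, mul_comm]

theorem comp_neg_X_eq_iff (p : ℂ[X]) : p.comp (-X) = p ↔ ∀ k, ¬ 2 ∣ k → p.coeff k = 0 := by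
  rw [Polynomial.ext_iff]
  refine forall_congr' fun k => ?_
  rw [coeff_comp_neg_X]
  rcases Nat.even_or_odd k with hk | hk
  · simp [hk.neg_one_pow, hk.two_dvd]
  · have h2 : ¬ 2 ∣ k := fun h => (Nat.not_even_iff_odd.mpr hk) (even_iff_two_dvd.mpr h)
    simp only [hk.neg_one_pow, h2, not_false_eq_true, forall_const, neg_mul, one_mul]
    exact neg_eq_self

theorem mem_admissiblePolynomials_iff {h : Bool} {δ : ℕ} {φ : ℂ[X]} :
    φ ∈ admissiblePolynomials h δ ↔
      φ.Monic ∧ φ.natDegree = δ ∧ ∀ k, ¬ stride h ∣ k → φ.coeff k = 0 := by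
  cases h
  · simp [admissiblePolynomials, monicPolynomials, stride]
  · simp [admissiblePolynomials, evenMonicPolynomials, stride, comp_neg_X_eq_iff]

/-- The monic polynomial `s ^ (e m) + ∑ y_j s ^ (e j)`. -/
def stridePolynomial {R : Type*} [CommRing R] (e : ℕ) {m : ℕ} (y : Fin m → R) : R[X] :=
  X ^ (e * m) + ∑ j, C (y j) * X ^ (e * j.val)

theorem degree_sum_stride_lt {R : Type*} [CommRing R] {e m : ℕ} (he : 0 < e) (y : Fin m → R) :
    (∑ j, C (y j) * X ^ (e * j.val)).degree <
      ((e * m : ℕ) : WithBot ℕ) := by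
  rw [← mem_degreeLT]
  refine Submodule.sum_mem _ fun j _ => mem_degreeLT.mpr ?_
  refine (degree_C_mul_X_pow_le _ _).trans_lt ?_
  exact_mod_cast Nat.mul_lt_mul_of_pos_left j.2 he

theorem stridePolynomial_monic {R : Type*} [CommRing R] {e m : ℕ} (he : 0 < e) (y : Fin m → R) :
    (stridePolynomial e y).Monic :=
  monic_X_pow_add (degree_sum_stride_lt he y)

theorem natDegree_stridePolynomial {R : Type*} [CommRing R] [Nontrivial R] {e m : ℕ}
    (he : 0 < e) (y : Fin m → R) : (stridePolynomial e y).natDegree = e * m :=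
  natDegree_eq_of_degree_eq_some <| by
    rw [stridePolynomial, degree_add_eq_left_of_degree_lt, degree_X_pow]
    rw [degree_X_pow]
    exact degree_sum_stride_lt he y

theorem coeff_stridePolynomial_of_not_dvd {R : Type*} [CommRing R] {e m : ℕ} (y : Fin m → R)
    {k : ℕ} (hk : ¬ e ∣ k) : (stridePolynomial e y).coeff k = 0 := by
  have h (j : ℕ) : k ≠ e * j := fun h => hk ⟨j, h⟩
  simp [stridePolynomial, coeff_X_pow, h]

theorem coeff_stridePolynomial_mul {R : Type*} [CommRing R] {e m : ℕ} (he : 0 < e)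
    (y : Fin m → R) (j : Fin m) : (stridePolynomial e y).coeff (e * j) = y j := by
  rw [stridePolynomial, coeff_add, coeff_X_pow, if_neg, zero_add, finsetSum_coeff,
    Finset.sum_eq_single j]
  · simp
  · intro i _ hi
    rw [coeff_C_mul, coeff_X_pow, if_neg, mul_zero]
    intro h
    exact hi (Fin.ext (Nat.eq_of_mul_eq_mul_left he h).symm)
  · simp
  · intro h
    exact j.2.ne (Nat.eq_of_mul_eq_mul_left he h)

theorem stridePolynomial_mem (h : Bool) {m : ℕ} (y : Fin m → ℂ) :
    stridePolynomial (stride h) y ∈ admissiblePolynomials h (stride h * m) :=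
  mem_admissiblePolynomials_iff.mpr ⟨stridePolynomial_monic (stride_pos h) y,
    natDegree_stridePolynomial (stride_pos h) y, fun _ => coeff_stridePolynomial_of_not_dvd y⟩

theorem eq_stridePolynomial {h : Bool} {m : ℕ} {φ : ℂ[X]}
    (hφ : φ ∈ admissiblePolynomials h (stride h * m)) :
    φ = stridePolynomial (stride h) fun j : Fin m => φ.coeff (stride h * j) := by
  obtain ⟨h1, h2, h3⟩ := mem_admissiblePolynomials_iff.mp hφ
  have he := stride_pos h
  ext k
  by_cases hk : stride h ∣ k
  · obtain ⟨j, rfl⟩ := hk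
    rcases lt_trichotomy j m with hj | rfl | hj
    · exact (coeff_stridePolynomial_mul he (fun i : Fin m => φ.coeff (stride h * i)) ⟨j, hj⟩).symm
    · have h4 := stridePolynomial_monic he fun i : Fin j => φ.coeff (stride h * i)
      have h5 := h4.coeff_natDegree
      rw [natDegree_stridePolynomial he] at h5
      rw [h5, ← h2]
      exact h1.coeff_natDegree
    · have hlt : stride h * m < stride h * j := Nat.mul_lt_mul_of_pos_left hj he
      have h4 := natDegree_stridePolynomial he fun i : Fin m => φ.coeff (stride h * i)
      rw [coeff_eq_zero_of_natDegree_lt (h2.trans_lt hlt),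
        coeff_eq_zero_of_natDegree_lt (h4.trans_lt hlt)]
  · rw [h3 k hk, coeff_stridePolynomial_of_not_dvd _ hk]

/-- The characteristic polynomial of a self-dual system is admissible. -/
theorem charpoly_mem_admissiblePolynomials (h : Bool) {m : ℕ}
    {S K : Matrix (Fin (stride h * m)) (Fin (stride h * m)) ℂ} (hS : S.transpose = sign h • S)
    (hK : K.transpose = K) :
    (S * K).charpoly ∈ admissiblePolynomials h (stride h * m) := by
  have hdeg : (S * K).charpoly.natDegree = stride h * m := by
    rw [Matrix.charpoly_natDegree_eq_dim, Fintype.card_fin]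
  cases h
  · exact ⟨(S * K).charpoly_monic, hdeg⟩
  · refine ⟨(S * K).charpoly_monic, hdeg, ?_⟩
    -- Here (SK)ᵗ = KSᵗ = −KS, and KS has the same characteristic polynomial as SK. The sign left
    -- over in χ(−s) is (−1)²ᵐ = 1.
    have h1 : (S * K).charpoly = (-(S * K)).charpoly := by
      rw [← Matrix.charpoly_transpose, Matrix.transpose_mul, hS, hK, Matrix.mul_smul,
        ← Matrix.smul_mul, Matrix.charpoly_mul_comm, Matrix.mul_smul]
      simp [sign]
    refine Polynomial.funext fun x => ?_
    conv_rhs => rw [h1]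
    rw [eval_comp, Matrix.eval_charpoly, Matrix.eval_charpoly]
    have h2 : Matrix.scalar _ (eval x (-X)) - S * K = -(Matrix.scalar _ x - -(S * K)) := by
      rw [eval_neg, eval_X, map_neg]
      abel
    rw [h2, Matrix.det_neg, Fintype.card_fin]
    simp [stride]

end Admissible

/-! ### Characteristic polynomials of affine families of matrices -/

section AffineFamily

variable {σ : Type*} [Fintype σ] {d : ℕ}

/-- The `k`-th coefficient of the characteristic polynomial of `A + ∑ x_s L_s` as a polynomial
in `x`. -/
def affineCharpolyCoeff (A : Matrix (Fin d) (Fin d) ℂ) (L : σ → Matrix (Fin d) (Fin d) ℂ)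
    (k : ℕ) : MvPolynomial σ ℂ :=
  (A.map MvPolynomial.C + ∑ s, (MvPolynomial.X s : MvPolynomial σ ℂ) •
    (L s).map MvPolynomial.C).charpoly.coeff k

theorem map_affineCharpolyCoeff {R : Type*} [CommRing R] (f : MvPolynomial σ ℂ →+* R)
    (A : Matrix (Fin d) (Fin d) ℂ) (L : σ → Matrix (Fin d) (Fin d) ℂ) (k : ℕ) :
    f (affineCharpolyCoeff A L k) =
      (A.map (f.comp MvPolynomial.C) + ∑ s, f (MvPolynomial.X s) •
        (L s).map (f.comp MvPolynomial.C)).charpoly.coeff k := by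
  rw [affineCharpolyCoeff, ← coeff_map, ← Matrix.charpoly_map]
  congr 2
  ext i j
  simp [Matrix.sum_apply]

theorem eval_affineCharpolyCoeff (A : Matrix (Fin d) (Fin d) ℂ)
    (L : σ → Matrix (Fin d) (Fin d) ℂ) (k : ℕ) (x : σ → ℂ) :
    MvPolynomial.eval x (affineCharpolyCoeff A L k) =
      (A + ∑ s, x s • L s).charpoly.coeff k := by
  rw [map_affineCharpolyCoeff]
  congr 2
  ext i j
  simp [Matrix.sum_apply]

end AffineFamily

/-! ### The negative part: too few feedback parameters -/

section NotAssignable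

variable {n : ℕ}

theorem eval_aeval {R σ τ : Type*} [CommRing R] (x : σ → R) (p : τ → MvPolynomial σ R)
    (Q : MvPolynomial τ R) : MvPolynomial.eval x (MvPolynomial.aeval p Q) =
      MvPolynomial.eval (fun j => MvPolynomial.eval x (p j)) Q := by
  induction Q using MvPolynomial.induction_on with
  | C a => simp
  | add f g hf hg => rw [map_add, map_add, map_add, hf, hg]
  | mul_X f i hf => rw [map_mul, map_mul, map_mul, hf]; simp

theorem sum_sym2_smul {F : Matrix (Fin n) (Fin n) ℂ} (hF : F.IsSymm) :
    ∑ s : Sym2 (Fin n), Sym2.lift ⟨fun i j => F i j, fun i j => hF.apply j i⟩ s •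
      (Matrix.of fun i j => if s(i, j) = s then (1 : ℂ) else 0) = F := by
  ext i j
  simp [Matrix.sum_apply]

/-- With fewer parameters than coefficients, some real admissible polynomial is not assigned. -/
theorem exists_not_assignable (h : Bool) {m : ℕ} {G : TransferFunction n}
    (hG : HasMcMillanDegree G (stride h * m)) (hm : (n + 1).choose 2 < m) :
    ∃ φ : ℝ[X], φ.map Complex.ofRealHom ∈ admissiblePolynomials h (stride h * m) ∧
      ¬ Assignable G (φ.map Complex.ofRealHom) := by
  obtain ⟨A, B, C, hr⟩ := hG.1
  rw [isRealization_iff] at hr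
  let p : Fin m → MvPolynomial (Sym2 (Fin n)) ℂ := fun j => affineCharpolyCoeff A
    (fun s => B * (Matrix.of fun i j => if s(i, j) = s then (1 : ℂ) else 0) * C) (stride h * j)
  -- Symmetric feedback has one parameter for each unordered pair of indices, so the m coefficients
  -- satisfy a relation Q. As ℝ is infinite, Q is nonzero at some real y, whose polynomial is then
  -- out of reach even for complex feedback.
  obtain ⟨Q, hQ0, hQ⟩ := exists_aeval_eq_zero_of_card_lt (by simpa [Sym2.card] using hm) p
  have hne : ∃ y : Fin m → ℝ, MvPolynomial.eval (fun j => (y j : ℂ)) Q ≠ 0 := by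
    by_contra! hall
    refine hQ0 (MvPolynomial.funext_set (fun _ => Set.range ((↑) : ℝ → ℂ))
      (fun _ => Set.infinite_range_of_injective Complex.ofReal_injective) fun x hx => ?_)
    choose y hy using fun i => hx i trivial
    rw [map_zero, ← hall y]
    congr 2
    funext i
    exact (hy i).symm
  obtain ⟨y, hy⟩ := hne
  have hmap : (stridePolynomial (stride h) y).map Complex.ofRealHom =
      stridePolynomial (stride h) fun j => (y j : ℂ) := by
    simp [stridePolynomial, Polynomial.map_sum]
  refine ⟨stridePolynomial (stride h) y, hmap ▸ stridePolynomial_mem h _, ?_⟩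
  rw [hmap]
  rintro ⟨F, hF, hchar⟩
  rw [hasCharacteristicPolynomial_closedLoop_iff hG hr] at hchar
  apply hy
  have h1 := congrArg (MvPolynomial.eval
    (Sym2.lift ⟨fun i j => F i j, fun i j => hF.apply j i⟩)) hQ
  rw [map_zero, eval_aeval] at h1
  rw [← h1]
  congr 2
  funext j
  have h2 : A + ∑ s : Sym2 (Fin n), Sym2.lift ⟨fun i j => F i j, fun i j => hF.apply j i⟩ s •
      (B * (Matrix.of fun i j => if s(i, j) = s then (1 : ℂ) else 0) * C) = A + B * F * C := by
    conv_rhs => rw [← sum_sym2_smul hF]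
    simp only [Matrix.mul_sum, Matrix.sum_mul, Matrix.mul_smul, Matrix.smul_mul]
  rw [eval_affineCharpolyCoeff, h2, hchar, coeff_stridePolynomial_mul (stride_pos h)]

theorem RealAssignable.assignable {G : TransferFunction n} {φ : ℂ[X]} (h : RealAssignable G φ) :
    Assignable G φ := by
  obtain ⟨F, hF, h⟩ := h
  exact ⟨_, hF.map _, h⟩

theorem not_poleAssignable (h : Bool) {m : ℕ} {G : TransferFunction n}
    (hG : HasMcMillanDegree G (stride h * m)) (hm : (n + 1).choose 2 < m) :
    ¬ PoleAssignable (admissiblePolynomials h (stride h * m)) G ∧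
      ¬ RealPoleAssignable (admissiblePolynomials h (stride h * m)) G := by
  obtain ⟨φ, hφ, hna⟩ := exists_not_assignable h hG hm
  exact ⟨fun H => hna (H _ hφ), fun H => hna (H φ hφ).assignable⟩

end NotAssignable

/-! ### First order variation of the characteristic polynomial -/

section Jacobi

variable {d n : ℕ}

/-- Jacobi's formula at an invertible matrix. -/
theorem coeff_one_det_add_X_smul {ι K : Type*} [Fintype ι] [DecidableEq ι] [Field K]
    (M L : Matrix ι ι K) (hM : M.det ≠ 0) :
    (M.map C + (X : K[X]) • L.map C).det.coeff 1 = (M.adjugate * L).trace := by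
  have hu : IsUnit M.det := hM.isUnit
  have h1 : M.map C + (X : K[X]) • L.map C = M.map C * (1 + (X : K[X]) • (M⁻¹ * L).map C) := by
    rw [mul_add, mul_one, Matrix.mul_smul, ← Matrix.map_mul, ← mul_assoc,
      Matrix.mul_nonsing_inv _ hu, one_mul]
  have h2 : (M.map C).det = C M.det := (RingHom.map_det C M).symm
  rw [h1, Matrix.det_mul, h2, coeff_C_mul, Matrix.coeff_det_one_add_X_smul_one, Matrix.inv_def,
    Ring.inverse_eq_inv', Matrix.smul_mul, Matrix.trace_smul, smul_eq_mul, ← mul_assoc,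
    mul_inv_cancel₀ hM, one_mul]

/-- The first order change of the characteristic polynomial of `A` in direction `L`. -/
theorem coeff_one_coeff_charpoly_add_X_smul (A L : Matrix (Fin d) (Fin d) ℂ) (k : ℕ) :
    ((A.map C + (X : ℂ[X]) • L.map C).charpoly.coeff k).coeff 1 =
      -(A.charmatrix.adjugate * L.map C).trace.coeff k := by
  set Θ := (A.map C + (X : ℂ[X]) • L.map C).charpoly with hΘ
  have hdeg : Θ.natDegree < d + 1 := by
    rw [hΘ, Matrix.charpoly_natDegree_eq_dim, Fintype.card_fin]
    exact Nat.lt_succ_self d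
  set r : ℂ[X] := ∑ i ∈ Finset.range (d + 1), C ((Θ.coeff i).coeff 1) * X ^ i with hr
  -- Jacobi's formula is used where s − A is invertible; the minus sign comes from s − (A + XL). The
  -- factor `A.charpoly` below removes the excluded values of s.
  have heval (s : ℂ) (hs : A.charpoly.eval s ≠ 0) :
      r.eval s = (-(A.charmatrix.adjugate * L.map C).trace).eval s := by
    have h1 : (Θ.eval (C s)).coeff 1 = r.eval s := by
      rw [eval_eq_sum_range' hdeg, finsetSum_coeff, hr, eval_finsetSum]
      refine Finset.sum_congr rfl fun i _ => ?_
      rw [← C_pow, coeff_mul_C]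
      simp
    have h2 : Θ.eval (C s) =
        ((Matrix.scalar _ s - A).map C + (X : ℂ[X]) • (-L).map C).det := by
      rw [hΘ, Matrix.eval_charpoly]
      congr 1
      ext i j
      by_cases hij : i = j
      · subst hij; simp; ring
      · simp [hij]; ring
    have h3 : (Matrix.scalar _ s - A).det ≠ 0 := by rwa [← Matrix.eval_charpoly]
    rw [← h1, h2, coeff_one_det_add_X_smul _ _ h3]
    have h4 : (Matrix.scalar _ s - A).adjugate = A.charmatrix.adjugate.map (eval s) := by
      have h5 : Matrix.scalar _ s - A = A.charmatrix.map (eval s) := by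
        ext i j
        by_cases hij : i = j
        · subst hij; simp
        · simp [hij]
      rw [h5]
      exact ((evalRingHom s).map_adjugate A.charmatrix).symm
    rw [h4, eval_neg]
    simp [Matrix.trace, Matrix.mul_apply, eval_finsetSum]
  have hpoly : r = -(A.charmatrix.adjugate * L.map C).trace := by
    have h1 : A.charpoly * r = A.charpoly * -(A.charmatrix.adjugate * L.map C).trace := by
      refine Polynomial.funext fun s => ?_
      rw [eval_mul, eval_mul]
      by_cases hs : A.charpoly.eval s = 0
      · rw [hs, zero_mul, zero_mul]
      · rw [heval s hs]
    exact mul_left_cancel₀ A.charpoly_monic.ne_zero h1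
  rw [← coeff_neg, ← hpoly, hr, finsetSum_coeff]
  by_cases hk : k ∈ Finset.range (d + 1)
  · rw [Finset.sum_eq_single_of_mem k hk]
    · simp
    · intro i _ hi
      simp [coeff_X_pow, hi.symm]
  · rw [coeff_eq_zero_of_natDegree_lt (p := Θ) (by rw [Finset.mem_range] at hk; omega), coeff_zero]
    refine (Finset.sum_eq_zero fun i hi => ?_).symm
    have : k ≠ i := fun h => hk (h ▸ hi)
    simp [coeff_X_pow, this]

/-- Restriction to the coordinate axis of `l` turns the partial derivative at the origin into the
linear coefficient of a one-variable polynomial. -/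
theorem eval_zero_pderiv {σ R : Type*} [DecidableEq σ] [CommRing R] (p : MvPolynomial σ R)
    (l : σ) : MvPolynomial.eval 0 (MvPolynomial.pderiv l p) =
      (MvPolynomial.aeval (Pi.single l (X : R[X])) p).coeff 1 := by
  have h0 (p : MvPolynomial σ R) :
      (MvPolynomial.aeval (Pi.single l (X : R[X])) p).coeff 0 = MvPolynomial.eval 0 p := by
    induction p using MvPolynomial.induction_on with
    | C a => simp
    | add f g hf hg => rw [map_add, map_add, coeff_add, hf, hg]
    | mul_X f i hf =>
      rw [map_mul, map_mul, mul_coeff_zero, hf, MvPolynomial.aeval_X, MvPolynomial.eval_X]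
      by_cases hi : i = l
      · subst hi; simp
      · simp [hi]
  induction p using MvPolynomial.induction_on with
  | C a => simp
  | add f g hf hg => rw [map_add, map_add, map_add, coeff_add, hf, hg]
  | mul_X f i hf =>
    rw [Derivation.leibniz, map_add, smul_eq_mul, smul_eq_mul, map_mul, map_mul, map_mul,
      MvPolynomial.aeval_X, MvPolynomial.eval_X, MvPolynomial.pderiv_X]
    by_cases hi : i = l
    · subst hi; simp [h0]
    · simp [hi]

theorem eval_zero_pderiv_affineCharpolyCoeff {σ : Type*} [Fintype σ] [DecidableEq σ]
    (A : Matrix (Fin d) (Fin d) ℂ) (L : σ → Matrix (Fin d) (Fin d) ℂ) (k : ℕ) (l : σ) :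
    MvPolynomial.eval 0 (MvPolynomial.pderiv l (affineCharpolyCoeff A L k)) =
      -(A.charmatrix.adjugate * (L l).map C).trace.coeff k := by
  rw [eval_zero_pderiv, ← coeff_one_coeff_charpoly_add_X_smul]
  have h1 := map_affineCharpolyCoeff
    (MvPolynomial.aeval (R := ℂ) (Pi.single l (X : ℂ[X]))).toRingHom A L k
  have h2 : ((MvPolynomial.aeval (R := ℂ) (Pi.single l (X : ℂ[X]))).toRingHom.comp
      MvPolynomial.C : ℂ → ℂ[X]) = C := by
    funext a
    simp
  have h3 : ∑ s, (MvPolynomial.aeval (R := ℂ) (Pi.single l (X : ℂ[X]))).toRingHom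
      (MvPolynomial.X s) • (L s).map C = (X : ℂ[X]) • (L l).map C := by
    rw [Finset.sum_eq_single l]
    · simp
    · intro s _ hs
      simp [hs]
    · simp
  rw [h2, h3] at h1
  exact congrArg (coeff · 1) h1

/-- The coefficient of `s ^ (-k-1)` in the fraction `r / q`, as a linear function of `r`. -/
def expansionCoeff {q : ℂ[X]} (hq : q.Monic) (k : ℕ) : ℂ[X] →ₗ[ℂ] ℂ where
  toFun r := (r * X ^ (k + 1) /ₘ q).coeff 0
  map_add' r r' := by
    rw [← coeff_add]
    congr 1
    refine (div_modByMonic_unique _ (r * X ^ (k + 1) %ₘ q + r' * X ^ (k + 1) %ₘ q) hq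
      ⟨?_, ?_⟩).1
    · rw [add_mul]
      conv_rhs => rw [← modByMonic_add_div (r * X ^ (k + 1)) q,
        ← modByMonic_add_div (r' * X ^ (k + 1)) q]
      ring
    · exact (degree_add_le _ _).trans_lt
        (max_lt (degree_modByMonic_lt _ hq) (degree_modByMonic_lt _ hq))
  map_smul' a r := by
    rw [RingHom.id_apply, ← coeff_smul]
    congr 1
    refine (div_modByMonic_unique _ (a • (r * X ^ (k + 1) %ₘ q)) hq ⟨?_, ?_⟩).1
    · rw [smul_mul_assoc]
      conv_rhs => rw [← modByMonic_add_div (r * X ^ (k + 1)) q]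
      rw [smul_add, mul_smul_comm]
    · exact (degree_smul_le _ _).trans_lt (degree_modByMonic_lt _ hq)

end Jacobi

/-! ### From a nonzero Markov determinant to generic assignability -/

section Generic

variable {n : ℕ}

/-- The index `e j + e - 1`, with `e = stride h`, of the `j`-th symmetric Markov parameter. -/
def markovIndex (h : Bool) (j : ℕ) : ℕ := stride h * j + (stride h - 1)

theorem sign_pow_markovIndex (h : Bool) (j : ℕ) : sign h ^ (markovIndex h j + 1) = 1 := by
  cases h
  · simp [sign]
  · have : markovIndex true j + 1 = 2 * (j + 1) := by simp only [markovIndex, stride, cond_true]; omega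
    rw [this, pow_mul]
    simp [sign]

/-- Transposition reverses the word SKS⋯KS, and each of its k + 1 factors S contributes one sign.
Hence the Markov parameters at `markovIndex` are symmetric, and the others, which occur only in the
Hamiltonian case, are skew. -/
theorem transpose_markov {ι : Type*} [Fintype ι] [DecidableEq ι] (h : Bool) {S K : Matrix ι ι ℂ}
    (C : Matrix (Fin n) ι ℂ) (hS : S.transpose = sign h • S) (hK : K.transpose = K) (k : ℕ) :
    (C * (S * K) ^ k * (S * C.transpose)).transpose =
      sign h ^ (k + 1) • (C * (S * K) ^ k * (S * C.transpose)) := by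
  have h1 : ((S * K) ^ k * S).transpose = sign h ^ (k + 1) • ((S * K) ^ k * S) := by
    induction k with
    | zero => simp [hS]
    | succ k ih =>
      rw [pow_succ', Matrix.mul_assoc (S * K), Matrix.transpose_mul, ih, Matrix.transpose_mul, hK,
        hS, pow_succ _ (k + 1), ← Matrix.mul_assoc (S * K), ← pow_succ' (S * K),
        pow_succ (S * K) k]
      simp only [Matrix.mul_smul, Matrix.smul_mul, smul_smul, Matrix.mul_assoc]
      rw [mul_comm (sign h)]
  have h2 : C * (S * K) ^ k * (S * C.transpose) = C * ((S * K) ^ k * S) * C.transpose := by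
    simp only [Matrix.mul_assoc]
  rw [h2, Matrix.transpose_mul, Matrix.transpose_mul, h1, Matrix.transpose_transpose]
  simp only [Matrix.mul_smul, Matrix.smul_mul, Matrix.mul_assoc]

theorem markov_markovIndex_symm {ι : Type*} [Fintype ι] [DecidableEq ι] (h : Bool)
    {S K : Matrix ι ι ℂ} (C : Matrix (Fin n) ι ℂ) (hS : S.transpose = sign h • S)
    (hK : K.transpose = K) (j : ℕ) (a b : Fin n) :
    (C * (S * K) ^ markovIndex h j * (S * C.transpose)) a b =
      (C * (S * K) ^ markovIndex h j * (S * C.transpose)) b a := by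
  have := congrFun (congrFun (transpose_markov h C hS hK (markovIndex h j)) b) a
  rwa [sign_pow_markovIndex, one_smul] at this

theorem eq_sum_stride {h : Bool} {m : ℕ} {r : ℂ[X]}
    (hdeg : r.degree < ((stride h * m : ℕ) : WithBot ℕ))
    (hoff : ∀ k, ¬ stride h ∣ k → r.coeff k = 0) :
    r = ∑ j : Fin m, r.coeff (stride h * j) • (X : ℂ[X]) ^ (stride h * j.val) := by
  -- Adding the leading term makes r admissible, so that `eq_stridePolynomial` gives its expansion.
  have hmem : X ^ (stride h * m) + r ∈ admissiblePolynomials h (stride h * m) := by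
    refine mem_admissiblePolynomials_iff.mpr ⟨monic_X_pow_add hdeg, ?_, fun k hk => ?_⟩
    · refine natDegree_eq_of_degree_eq_some ?_
      rw [degree_add_eq_left_of_degree_lt, degree_X_pow]
      rwa [degree_X_pow]
    · rw [coeff_add, hoff k hk, add_zero, coeff_X_pow, if_neg]
      rintro rfl
      exact hk ⟨m, rfl⟩
  have h1 := eq_stridePolynomial hmem
  conv at h1 => rhs; rw [stridePolynomial]
  conv_lhs => rw [add_left_cancel h1]
  refine Finset.sum_congr rfl fun j _ => ?_
  rw [coeff_add, coeff_X_pow, if_neg, zero_add, smul_eq_C_mul]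
  exact fun h' => j.2.ne (Nat.eq_of_mul_eq_mul_left (stride_pos h) h')

theorem trace_adjugate_mul_single {d : ℕ} (A : Matrix (Fin d) (Fin d) ℂ)
    (B : Matrix (Fin d) (Fin n) ℂ) (C : Matrix (Fin n) (Fin d) ℂ) (a b : Fin n) :
    (A.charmatrix.adjugate * (B * Matrix.single a b (1 : ℂ) * C).map Polynomial.C).trace =
      numerator A B C b a := by
  have h1 : (Matrix.single a b (1 : ℂ)).map Polynomial.C = Matrix.single a b 1 := by
    simp
  rw [Matrix.map_mul, Matrix.map_mul, h1, ← Matrix.mul_assoc, Matrix.trace_mul_comm,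
    ← Matrix.mul_assoc, ← Matrix.mul_assoc, ← numerator]
  simp [Matrix.trace_mul_single]

/-- At F = 0, the derivative of the characteristic polynomial in the direction E_ab + E_ba is −(N_ab
+ N_ba), where N is the numerator matrix. Expanding N/charpoly(A) at infinity is linear in N and
produces Markov parameters, so the matrix in `hc`, up to a factor 2, is a product with the Jacobian
ρ as a factor. Thus ρ is nonsingular and the feedback map is dominant. -/
theorem genericallyPoleAssignable_of_det_ne_zero (h : Bool) {m : ℕ} {G : TransferFunction n}
    (hG : HasMcMillanDegree G (stride h * m))
    {S K : Matrix (Fin (stride h * m)) (Fin (stride h * m)) ℂ}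
    {C : Matrix (Fin n) (Fin (stride h * m)) ℂ} (hS : S.transpose = sign h • S)
    (hK : K.transpose = K) (hr : G = transferFunction (S * K) (S * C.transpose) C)
    (c : Fin m → Fin n × Fin n)
    (hc : (Matrix.of fun j l : Fin m => (C * (S * K) ^ markovIndex h j * (S * C.transpose))
      (c l).1 (c l).2).det ≠ 0) :
    GenericallyPoleAssignable (stride h * m) (admissiblePolynomials h (stride h * m)) G := by
  set A := S * K with hA
  set B := S * C.transpose with hB
  let D : Fin m → Matrix (Fin n) (Fin n) ℂ := fun l =>
    Matrix.single (c l).1 (c l).2 1 + Matrix.single (c l).2 (c l).1 1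
  have hD (l) : (D l).transpose = D l := by simp [D, add_comm]
  let L : Fin m → Matrix _ _ ℂ := fun l => B * D l * C
  have hAL (x : Fin m → ℂ) : A + ∑ l, x l • L l = A + B * (∑ l, x l • D l) * C := by
    simp only [L, Matrix.mul_sum, Matrix.sum_mul, Matrix.mul_smul, Matrix.smul_mul]
  have hF (x : Fin m → ℂ) : (∑ l, x l • D l).transpose = ∑ l, x l • D l := by
    simp only [Matrix.transpose_sum, Matrix.transpose_smul, hD]
  have hadm (x : Fin m → ℂ) : (A + ∑ l, x l • L l).charpoly ∈
      admissiblePolynomials h (stride h * m) := by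
    have h1 : A + ∑ l, x l • L l = S * (K + C.transpose * (∑ l, x l • D l) * C) := by
      rw [hAL, hA, hB, mul_add]
      simp only [Matrix.mul_assoc]
    rw [h1]
    refine charpoly_mem_admissiblePolynomials h hS ?_
    rw [Matrix.transpose_add, Matrix.transpose_mul, Matrix.transpose_mul, hF, hK,
      Matrix.transpose_transpose, Matrix.mul_assoc]
  let p : Fin m → MvPolynomial (Fin m) ℂ := fun j => affineCharpolyCoeff A L (stride h * j)
  let r : Fin m → ℂ[X] := fun l => (A.charmatrix.adjugate * (L l).map Polynomial.C).trace
  have hrl (l) : r l = numerator A B C (c l).2 (c l).1 + numerator A B C (c l).1 (c l).2 := by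
    simp only [r, L, D, Matrix.mul_add, Matrix.add_mul]
    rw [Matrix.map_add _ (map_add _), Matrix.mul_add, Matrix.trace_add,
      trace_adjugate_mul_single, trace_adjugate_mul_single]
  -- The whole family is admissible, so coefficients off the stride vanish identically in x, and so
  -- do their derivatives.
  have hoff (l) (k) (hk : ¬ stride h ∣ k) : (r l).coeff k = 0 := by
    have h1 : affineCharpolyCoeff A L k = 0 := by
      refine MvPolynomial.funext fun x => ?_
      rw [eval_affineCharpolyCoeff, map_zero]
      exact (mem_admissiblePolynomials_iff.mp (hadm x)).2.2 k hk
    have h2 := eval_zero_pderiv_affineCharpolyCoeff A L k l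
    rw [h1, map_zero, map_zero] at h2
    exact neg_eq_zero.mp h2.symm
  have hdeg (l) : (r l).degree < ((stride h * m : ℕ) : WithBot ℕ) := by
    have h1 : A.charpoly.degree = ((stride h * m : ℕ) : WithBot ℕ) := by
      rw [A.charpoly_degree_eq_dim, Fintype.card_fin]
    rw [hrl, ← h1]
    exact (degree_add_le _ _).trans_lt
      (max_lt (degree_numerator_lt _ _ _ _ _) (degree_numerator_lt _ _ _ _ _))
  let ρ : Matrix (Fin m) (Fin m) ℂ := Matrix.of fun i l => (r l).coeff (stride h * i)
  let w : Matrix (Fin m) (Fin m) ℂ := Matrix.of fun j i =>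
    expansionCoeff A.charpoly_monic (markovIndex h j) (X ^ (stride h * i.val))
  have hwρ : w * ρ = (2 : ℂ) • Matrix.of fun j l : Fin m =>
      (C * A ^ markovIndex h j * B) (c l).1 (c l).2 := by
    ext j l
    have h1 := congrArg (expansionCoeff A.charpoly_monic (markovIndex h j))
      (eq_sum_stride (hdeg l) (hoff l))
    rw [map_sum] at h1
    have h2 : expansionCoeff A.charpoly_monic (markovIndex h j) (r l) =
        2 * (C * A ^ markovIndex h j * B) (c l).1 (c l).2 := by
      rw [hrl, map_add, two_mul]
      conv_rhs => lhs; rw [hA, hB, markov_markovIndex_symm h C hS hK]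
      exact congrArg₂ (· + ·) (coeff_zero_numerator_mul_X_pow_divByMonic _ _ _ _ _ _)
        (coeff_zero_numerator_mul_X_pow_divByMonic _ _ _ _ _ _)
    rw [Matrix.smul_apply, Matrix.of_apply, smul_eq_mul, ← h2, h1, Matrix.mul_apply]
    refine Finset.sum_congr rfl fun i _ => ?_
    rw [map_smul, smul_eq_mul, mul_comm]
    rfl
  have hρ : ρ.det ≠ 0 := by
    intro h0
    have h1 := congrArg Matrix.det hwρ
    rw [Matrix.det_mul, h0, mul_zero, Matrix.det_smul] at h1
    exact mul_ne_zero (pow_ne_zero _ two_ne_zero) hc h1.symm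
  have hJ : (Matrix.of fun i j =>
      MvPolynomial.eval 0 (MvPolynomial.pderiv j (p i))) = -ρ := by
    ext i l
    exact eval_zero_pderiv_affineCharpolyCoeff A L (stride h * i) l
  have hind : AlgebraicIndependent ℂ p := by
    refine algebraicIndependent_of_det_pderiv_ne_zero p 0 ?_
    rw [hJ, Matrix.det_neg]
    exact mul_ne_zero (pow_ne_zero _ (neg_ne_zero.mpr one_ne_zero)) hρ
  obtain ⟨Q, hQ0, hQ⟩ := exists_eval_eq_of_algebraicIndependent p hind
  have hlt (j : Fin m) : stride h * j.val < stride h * m :=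
    Nat.mul_lt_mul_of_pos_left j.2 (stride_pos h)
  let ι : Fin m → Fin (stride h * m) := fun j => ⟨stride h * j, hlt j⟩
  refine ⟨{φ ∈ admissiblePolynomials h (stride h * m) |
    MvPolynomial.eval (fun j : Fin m => φ.coeff (stride h * j)) Q ≠ 0}, ⟨?_, ?_⟩, ?_⟩
  · refine ⟨{MvPolynomial.rename ι Q}, ?_⟩
    ext φ
    simp only [Set.mem_ofPred_eq, Set.mem_singleton_iff, exists_eq_left, MvPolynomial.eval_rename]
    rfl
  · rintro V ⟨P, rfl⟩ ⟨φ₀, hφ₀, q, hqP, hq⟩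
    -- q' restricts q to the admissible polynomials: coordinates off the stride become 0, and each
    -- inner sum has at most one nonzero term.
    let q' : MvPolynomial (Fin m) ℂ := MvPolynomial.aeval (fun k : Fin (stride h * m) =>
      (∑ j : Fin m, if ι j = k then MvPolynomial.X j else 0 : MvPolynomial (Fin m) ℂ)) q
    have hq' (φ : ℂ[X]) (hφ : φ ∈ admissiblePolynomials h (stride h * m)) :
        MvPolynomial.eval (fun j : Fin m => φ.coeff (stride h * j)) q' =
          MvPolynomial.eval (coeffCoords (stride h * m) φ) q := by
      rw [eval_aeval]
      congr 2
      funext k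
      rw [map_sum]
      by_cases hk : stride h ∣ k.val
      · obtain ⟨j, hj⟩ := hk
        have hjm : j < m := Nat.lt_of_mul_lt_mul_left (hj ▸ k.2)
        rw [Finset.sum_eq_single ⟨j, hjm⟩]
        · rw [if_pos (Fin.ext hj.symm), MvPolynomial.eval_X, coeffCoords, hj]
        · intro i _ hi
          rw [if_neg, map_zero]
          intro h'
          refine hi (Fin.ext (Nat.eq_of_mul_eq_mul_left (stride_pos h) ?_))
          rw [← hj, ← h']
        · simp
      · rw [coeffCoords, (mem_admissiblePolynomials_iff.mp hφ).2.2 _ hk]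
        refine Finset.sum_eq_zero fun i _ => ?_
        rw [if_neg, map_zero]
        rintro rfl
        exact hk ⟨i, rfl⟩
    have hq'0 : q' ≠ 0 := by
      intro h0
      rw [← hq' φ₀ hφ₀, h0, map_zero] at hq
      exact hq rfl
    -- Irreducibility of affine space: two nonzero polynomials have a common nonzero point.
    have hex : ∃ y, MvPolynomial.eval y (Q * q') ≠ 0 := by
      by_contra! hall
      exact mul_ne_zero hQ0 hq'0 (MvPolynomial.funext fun y => by rw [hall, map_zero])
    obtain ⟨y, hy⟩ := hex
    rw [map_mul] at hy
    have hmem := stridePolynomial_mem h y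
    have hcoeff : (fun j : Fin m => (stridePolynomial (stride h) y).coeff (stride h * j)) = y :=
      funext fun j => coeff_stridePolynomial_mul (stride_pos h) y j
    refine ⟨stridePolynomial (stride h) y, ⟨hmem, ?_⟩, hmem, q, hqP, ?_⟩
    · rw [hcoeff]
      exact left_ne_zero_of_mul hy
    · rw [← hq' _ hmem, hcoeff]
      exact right_ne_zero_of_mul hy
  · rintro φ ⟨hφ, hne⟩
    obtain ⟨x, hx⟩ := hQ _ hne
    refine ⟨∑ l, x l • D l, hF x, ?_⟩
    rw [hasCharacteristicPolynomial_closedLoop_iff hG hr, ← hAL, eq_stridePolynomial (hadm x),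
      eq_stridePolynomial hφ]
    congr 1
    funext j
    rw [← eval_affineCharpolyCoeff]
    exact hx j

end Generic

/-! ### A lower bound for the McMillan degree -/

section Minimality

variable {n : ℕ}

/-- The self-dual transfer functions of McMillan degree `δ`: symmetric, or Hamiltonian if
`h = true`. -/
def selfDualTransferFunctions (h : Bool) (δ n : ℕ) : Set (TransferFunction n) :=
  {G | dual h G = G ∧ StrictlyProper G ∧ HasMcMillanDegree G δ}

/-- The matrix formed by the entries at the positions `c` of the Markov parameters of index
`markovIndex h j`. -/
def markovMinor (h : Bool) {m : ℕ} (G : TransferFunction n) (c : Fin m → Fin n × Fin n) :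
    Matrix (Fin m) (Fin m) ℂ :=
  Matrix.of fun j l => markovParameter (G (c l).1 (c l).2) (markovIndex h j)

/-- By Cayley–Hamilton, a realization of dimension d imposes on the Markov parameters a recurrence
of order d with leading coefficient one. -/
theorem sum_charpoly_coeff_mul_markov {d : ℕ} (A : Matrix (Fin d) (Fin d) ℂ)
    (B : Matrix (Fin d) (Fin n) ℂ) (C : Matrix (Fin n) (Fin d) ℂ) (k : ℕ) (a b : Fin n) :
    ∑ i ∈ Finset.range (d + 1), A.charpoly.coeff i * (C * A ^ (k + i) * B) a b = 0 := by
  have h1 := A.aeval_self_charpoly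
  rw [aeval_eq_sum_range' (n := d + 1) (by simp)] at h1
  have h2 := congrArg (fun M => (C * (A ^ k * M) * B) a b) h1
  simp only [Matrix.mul_sum, Matrix.sum_mul, Matrix.mul_smul, Matrix.smul_mul, ← pow_add,
    Matrix.mul_zero, Matrix.zero_mul, Matrix.sum_apply, Matrix.smul_apply, smul_eq_mul,
    Matrix.zero_apply] at h2
  exact h2

/-- A self-dual transfer function with a nonsingular `markovMinor` has no realization of
dimension below `stride h * m`. -/
theorem le_of_det_markovMinor_ne_zero (h : Bool) {m d : ℕ} {G : TransferFunction n}
    (hdual : dual h G = G) {A : Matrix (Fin d) (Fin d) ℂ} {B : Matrix (Fin d) (Fin n) ℂ}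
    {C : Matrix (Fin n) (Fin d) ℂ} (hr : G = transferFunction A B C)
    {c : Fin m → Fin n × Fin n} (hc : (markovMinor h G c).det ≠ 0) : stride h * m ≤ d := by
  by_contra! hlt
  have hsymm (k : ℕ) (a b : Fin n) :
      (C * A ^ k * B) b a = sign h ^ (k + 1) * (C * A ^ k * B) a b := by
    rw [← markovParameter_transferFunction A B C b a, ← hr]
    conv_lhs => rw [← hdual, hr, dual_transferFunction]
    rw [markovParameter_transferFunction, _root_.smul_pow, ← Matrix.transpose_pow]
    have h1 : sign h • B.transpose * sign h ^ k • (A ^ k).transpose * C.transpose =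
        sign h ^ (k + 1) • (C * A ^ k * B).transpose := by
      rw [Matrix.transpose_mul, Matrix.transpose_mul, Matrix.smul_mul, Matrix.mul_smul,
        smul_smul, Matrix.smul_mul, Matrix.mul_assoc, pow_succ']
    rw [h1, Matrix.smul_apply, Matrix.transpose_apply, smul_eq_mul]
  -- The recurrence has to end at an index of symmetric type. In the Hamiltonian case these are odd,
  -- so it is shifted by one when d is even.
  obtain ⟨k₀, j₀, hj₀, hidx⟩ : ∃ k₀ j₀, j₀ < m ∧ d + k₀ = markovIndex h j₀ := by
    cases h
    · exact ⟨0, d, by simpa [stride] using hlt, by simp [markovIndex, stride]⟩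
    · simp only [stride, cond_true] at hlt
      rcases Nat.even_or_odd' d with ⟨j, hj | hj⟩
      · exact ⟨1, j, by omega, by simp only [markovIndex, stride, cond_true]; omega⟩
      · exact ⟨0, j, by omega, by simp only [markovIndex, stride, cond_true]; omega⟩
  -- The weights β produce a symmetrized combination f of entries whose first nonzero value is at
  -- `markovIndex h j₀`: other symmetric indices are killed by β, skew ones by the symmetrization.
  -- The recurrence would make this value zero.
  obtain ⟨β, hβ⟩ : ∃ β, (markovMinor h G c).mulVec β = Pi.single ⟨j₀, hj₀⟩ 1 :=
    Matrix.mulVec_surjective_iff_isUnit.mpr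
      ((Matrix.isUnit_iff_isUnit_det _).mpr hc.isUnit) _
  set f : ℕ → ℂ := fun k => ∑ l, β l *
    ((C * A ^ k * B) (c l).1 (c l).2 + (C * A ^ k * B) (c l).2 (c l).1) with hf
  have hf1 (j : Fin m) : f (markovIndex h j) = 2 * (Pi.single ⟨j₀, hj₀⟩ 1 : Fin m → ℂ) j := by
    rw [← hβ, Matrix.mulVec, dotProduct, Finset.mul_sum]
    refine Finset.sum_congr rfl fun l _ => ?_
    rw [hsymm _ (c l).1 (c l).2, sign_pow_markovIndex, markovMinor, Matrix.of_apply, hr,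
      markovParameter_transferFunction]
    ring
  have hf0 (k : ℕ) (hk : k < markovIndex h j₀) : f k = 0 := by
    by_cases hex : ∃ j, k = markovIndex h j
    · obtain ⟨j, rfl⟩ := hex
      have hjj : j < j₀ := Nat.lt_of_mul_lt_mul_left (Nat.add_lt_add_iff_right.mp hk)
      rw [hf1 ⟨j, hjj.trans hj₀⟩, Pi.single_eq_of_ne, mul_zero]
      exact fun h' => hjj.ne (Fin.ext_iff.mp h')
    · refine Finset.sum_eq_zero fun l _ => ?_
      cases h
      · exact absurd ⟨k, by simp [markovIndex, stride]⟩ hex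
      · have hev : Even k := by
          by_contra hodd
          obtain ⟨j, hj⟩ := Nat.not_even_iff_odd.mp hodd
          exact hex ⟨j, by simp only [markovIndex, stride, cond_true]; omega⟩
        rw [hsymm _ (c l).1 (c l).2]
        simp [sign, hev.add_one.neg_one_pow]
  have hrel : ∑ i ∈ Finset.range (d + 1), A.charpoly.coeff i * f (k₀ + i) = 0 := by
    simp only [hf, Finset.mul_sum]
    rw [Finset.sum_comm]
    refine Finset.sum_eq_zero fun l _ => ?_
    have h1 := sum_charpoly_coeff_mul_markov A B C k₀ (c l).1 (c l).2
    have h2 := sum_charpoly_coeff_mul_markov A B C k₀ (c l).2 (c l).1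
    calc _ = β l * (∑ i ∈ Finset.range (d + 1),
            A.charpoly.coeff i * (C * A ^ (k₀ + i) * B) (c l).1 (c l).2 +
          ∑ i ∈ Finset.range (d + 1),
            A.charpoly.coeff i * (C * A ^ (k₀ + i) * B) (c l).2 (c l).1) := by
          rw [← Finset.sum_add_distrib, Finset.mul_sum]
          exact Finset.sum_congr rfl fun i _ => by ring
      _ = 0 := by rw [h1, h2, add_zero, mul_zero]
  rw [Finset.sum_range_succ, Finset.sum_eq_zero, zero_add, add_comm k₀, hidx,
    hf1 ⟨j₀, hj₀⟩, Pi.single_eq_same] at hrel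
  · have h1 := A.charpoly_monic.coeff_natDegree
    rw [A.charpoly_natDegree_eq_dim, Fintype.card_fin] at h1
    rw [h1] at hrel
    norm_num at hrel
  · intro i hi
    rw [hf0, mul_zero]
    have := Finset.mem_range.mp hi
    omega

theorem transferFunction_mem_selfDual (h : Bool) {m : ℕ}
    {S K : Matrix (Fin (stride h * m)) (Fin (stride h * m)) ℂ}
    (C : Matrix (Fin n) (Fin (stride h * m)) ℂ) (hS : S.transpose = sign h • S)
    (hK : K.transpose = K) {c : Fin m → Fin n × Fin n}
    (hc : (markovMinor h (transferFunction (S * K) (S * C.transpose) C) c).det ≠ 0) :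
    transferFunction (S * K) (S * C.transpose) C ∈
      selfDualTransferFunctions h (stride h * m) n := by
  have hd := dual_transferFunction_eq_self h C hS hK
  refine ⟨hd, strictlyProper_transferFunction _ _ _, ⟨_, _, _, isRealization_iff.mpr rfl⟩, ?_⟩
  rintro d ⟨A, B, C', h'⟩
  exact le_of_det_markovMinor_ne_zero h hd h' hc

end Minimality

/-! ### An explicit self-dual system with nonzero Markov determinant -/

section Existence

variable {n : ℕ}

/-- The rank one matrices `b bᵗ`, for `b` the indicator vectors of distinct unordered pairs, are
linearly independent, as witnessed by their entries at the positions of these pairs. -/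
theorem det_sym2_indicator_ne_zero {m : ℕ} (g : Fin m → Sym2 (Fin n))
    (hg : Function.Injective g) (c : Fin m → Fin n × Fin n) (hc : ∀ r, s((c r).1, (c r).2) = g r) :
    (Matrix.of fun l r : Fin m => (if (c r).1 ∈ g l then (1 : ℂ) else 0) *
      (if (c r).2 ∈ g l then (1 : ℂ) else 0)).det ≠ 0 := by
  set M : Matrix (Fin m) (Fin m) ℂ := Matrix.of fun l r : Fin m =>
    (if (c r).1 ∈ g l then (1 : ℂ) else 0) * (if (c r).2 ∈ g l then (1 : ℂ) else 0) with hM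
  have hself (l) : M l l = 1 := by
    have h1 : (c l).1 ∈ g l := by rw [← hc]; exact Sym2.mem_mk_left _ _
    have h2 : (c l).2 ∈ g l := by rw [← hc]; exact Sym2.mem_mk_right _ _
    simp [hM, h1, h2]
  -- The entry is nonzero only if the pair of r lies inside the pair of l. The matrix is therefore
  -- triangular once the diagonal pairs are listed first, and its kernel is computed in that order.
  have hzero (l r) (hne : l ≠ r) (h : (g l).IsDiag ∨ ¬ (g r).IsDiag) : M l r = 0 := by
    by_contra h0
    have h1 : (c r).1 ∈ g l ∧ (c r).2 ∈ g l := by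
      simp only [hM, Matrix.of_apply] at h0
      by_contra hcon
      apply h0
      rw [not_and_or] at hcon
      rcases hcon with hcon | hcon <;> simp [hcon]
    refine hne (hg ?_)
    rw [← hc r]
    rcases h with h | h
    · rw [← hc l, Sym2.mk_isDiag_iff] at h
      rw [← hc l, h, Sym2.mem_iff, Sym2.mem_iff, or_self, or_self] at h1
      rw [← hc l, h, h1.1, h1.2]
    · rw [← hc r, Sym2.mk_isDiag_iff] at h
      exact (Sym2.mem_and_mem_iff h).mp h1
  intro hdet
  obtain ⟨v, hv0, hv⟩ := Matrix.exists_mulVec_eq_zero_iff.mpr hdet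
  have hrow (l) : ∑ r, M l r * v r = 0 := congrFun hv l
  have hdiag (l) (hl : (g l).IsDiag) : v l = 0 := by
    have := hrow l
    rwa [Finset.sum_eq_single l (fun r _ hr => by rw [hzero l r hr.symm (Or.inl hl), zero_mul])
      (by simp), hself, one_mul] at this
  refine hv0 (funext fun l => ?_)
  by_cases hl : (g l).IsDiag
  · exact hdiag l hl
  · have := hrow l
    rwa [Finset.sum_eq_single l _ (by simp), hself, one_mul] at this
    intro r _ hr
    by_cases hgr : (g r).IsDiag
    · rw [hdiag r hgr, mul_zero]
    · rw [hzero l r hr.symm (Or.inr hgr), zero_mul]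

/-- Since b Λʲ bᵗ = ∑ λᵢʲ bᵢbᵢᵗ, the matrix is a transposed Vandermonde matrix times the matrix of
entries of the bᵢbᵢᵗ. The nodes 0, …, m − 1 are distinct, and the bᵢ are indicators of m distinct
unordered pairs. -/
theorem exists_det_sum_pow_ne_zero {m : ℕ} (hm : m ≤ (n + 1).choose 2) :
    ∃ (b : Matrix (Fin n) (Fin m) ℂ) (c : Fin m → Fin n × Fin n),
      (Matrix.of fun j l : Fin m => (b * Matrix.diagonal (fun i : Fin m => (i : ℂ)) ^ j.val *
        b.transpose) (c l).1 (c l).2).det ≠ 0 := by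
  obtain ⟨g⟩ : Nonempty (Fin m ↪ Sym2 (Fin n)) :=
    Function.Embedding.nonempty_of_card_le (by simpa [Sym2.card] using hm)
  have hsurj (r) : ∃ p : Fin n × Fin n, s(p.1, p.2) = g r := by
    induction h : g r using Sym2.ind with
    | _ x y => exact ⟨(x, y), rfl⟩
  choose c hc using hsurj
  refine ⟨Matrix.of fun a l => if a ∈ g l then 1 else 0, c, ?_⟩
  have h1 : (Matrix.of fun j l : Fin m => ((Matrix.of fun a l => if a ∈ g l then (1 : ℂ) else 0) *
      Matrix.diagonal (fun i : Fin m => (i : ℂ)) ^ j.val *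
      (Matrix.of fun a l => if a ∈ g l then (1 : ℂ) else 0).transpose) (c l).1 (c l).2) =
      (Matrix.vandermonde fun i : Fin m => (i : ℂ)).transpose *
      Matrix.of fun l r : Fin m => (if (c r).1 ∈ g l then (1 : ℂ) else 0) *
      (if (c r).2 ∈ g l then (1 : ℂ) else 0) := by
    ext j l
    rw [Matrix.of_apply, Matrix.diagonal_pow, Matrix.mul_apply, Matrix.mul_apply]
    refine Finset.sum_congr rfl fun i _ => ?_
    rw [Matrix.mul_diagonal]
    simp only [Matrix.of_apply, Matrix.transpose_apply, Matrix.vandermonde_apply, Pi.pow_apply]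
    ring
  rw [h1, Matrix.det_mul, Matrix.det_transpose]
  refine mul_ne_zero (Matrix.det_vandermonde_ne_zero_iff.mpr fun i j hij => ?_)
    (det_sym2_indicator_ne_zero g g.injective c hc)
  exact Fin.ext (by exact_mod_cast hij)

/-- Self-dual systems with prescribed Markov parameters `b Λ ^ j bᵗ` at the indices
`markovIndex h j`. -/
theorem exists_selfDual_system_aux (h : Bool) {m : ℕ} (Λ : Fin m → ℂ)
    (b : Matrix (Fin n) (Fin m) ℂ) :
    ∃ (ι : Type) (_ : Fintype ι) (_ : DecidableEq ι) (S K : Matrix ι ι ℂ)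
      (C : Matrix (Fin n) ι ℂ), Fintype.card ι = stride h * m ∧ S.transpose = sign h • S ∧
        K.transpose = K ∧ ∀ j, C * (S * K) ^ markovIndex h j * (S * C.transpose) =
          b * Matrix.diagonal Λ ^ j * b.transpose := by
  cases h
  · refine ⟨Fin m, inferInstance, inferInstance, 1, Matrix.diagonal Λ, b, by simp [stride],
      by simp [sign], by simp, fun j => by simp [markovIndex, stride]⟩
  -- S is the standard symplectic matrix and K is chosen so that (SK)² = diag(Λ, Λ). Then (SK)²ʲ⁺¹S
  -- has Λʲ as its upper left block, the only one visible to C = (b 0).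
  · refine ⟨Fin m ⊕ Fin m, inferInstance, inferInstance, Matrix.fromBlocks 0 1 (-1) 0,
      Matrix.fromBlocks (Matrix.diagonal Λ) 0 0 (-1), Matrix.fromCols b 0,
      by simp [stride, two_mul], ?_, ?_, fun j => ?_⟩
    · simp [sign, Matrix.fromBlocks_transpose, Matrix.fromBlocks_neg]
    · simp [Matrix.fromBlocks_transpose]
    · have h1 : Matrix.fromBlocks (0 : Matrix (Fin m) (Fin m) ℂ) 1 (-1) 0 *
          Matrix.fromBlocks (Matrix.diagonal Λ) 0 0 (-1) =
          Matrix.fromBlocks 0 (-1) (-Matrix.diagonal Λ) (0 : Matrix (Fin m) (Fin m) ℂ) := by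
        simp [Matrix.fromBlocks_multiply]
      have h2 (j : ℕ) : Matrix.fromBlocks 0 (-1) (-Matrix.diagonal Λ) (0 : Matrix (Fin m) (Fin m) ℂ) ^ (2 * j) =
          Matrix.fromBlocks (Matrix.diagonal Λ ^ j) 0 0 (Matrix.diagonal Λ ^ j) := by
        rw [pow_mul]
        have h3 : Matrix.fromBlocks 0 (-1) (-Matrix.diagonal Λ) (0 : Matrix (Fin m) (Fin m) ℂ) ^ 2 =
            Matrix.fromBlocks (Matrix.diagonal Λ) 0 0 (Matrix.diagonal Λ) := by
          simp [sq, Matrix.fromBlocks_multiply]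
        rw [h3]
        induction j with
        | zero => simp
        | succ j ih => rw [pow_succ, ih, Matrix.fromBlocks_multiply]; simp [pow_succ]
      have h4 : markovIndex true j = 2 * j + 1 := rfl
      rw [h1, h4, pow_succ, h2, Matrix.transpose_fromCols, Matrix.fromBlocks_multiply]
      simp [Matrix.fromBlocks_mul_fromRows, Matrix.fromCols_mul_fromRows,
        Matrix.fromCols_mul_fromBlocks]

theorem exists_selfDual_system (h : Bool) {m : ℕ} (hm : m ≤ (n + 1).choose 2) :
    ∃ (S K : Matrix (Fin (stride h * m)) (Fin (stride h * m)) ℂ)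
      (C : Matrix (Fin n) (Fin (stride h * m)) ℂ) (c : Fin m → Fin n × Fin n),
      S.transpose = sign h • S ∧ K.transpose = K ∧
        (Matrix.of fun j l : Fin m => (C * (S * K) ^ markovIndex h j * (S * C.transpose))
          (c l).1 (c l).2).det ≠ 0 := by
  obtain ⟨b, c, hdet⟩ := exists_det_sum_pow_ne_zero hm
  obtain ⟨ι, _, _, S, K, C, hcard, hS, hK, hH⟩ :=
    exists_selfDual_system_aux h (fun i : Fin m => (i : ℂ)) b
  let e : Fin (stride h * m) ≃ ι := (Fintype.equivFinOfCardEq hcard).symm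
  refine ⟨S.submatrix e e, K.submatrix e e, C.submatrix id e, c, ?_, ?_, ?_⟩
  · rw [Matrix.transpose_submatrix, hS]; rfl
  · rw [Matrix.transpose_submatrix, hK]
  · convert hdet using 4 with j l
    rw [← hH, Matrix.submatrix_mul_equiv, Matrix.transpose_submatrix,
      Matrix.submatrix_mul_equiv]
    have hpow (k : ℕ) : (S * K).submatrix e e ^ k = ((S * K) ^ k).submatrix e e := by
      induction k with
      | zero => simp
      | succ k ih => rw [pow_succ, ih, Matrix.submatrix_mul_equiv, pow_succ]
    rw [hpow, Matrix.submatrix_mul_equiv, Matrix.submatrix_mul_equiv]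
    rfl

end Existence

/-! ### Openness and density of the good transfer functions -/

section Density

variable {n : ℕ}

/-- The self-dual transfer functions with some nonsingular `markovMinor`. -/
def goodTransferFunctions (h : Bool) (m n : ℕ) : Set (TransferFunction n) :=
  {G ∈ selfDualTransferFunctions h (stride h * m) n |
    ∃ c : Fin m → Fin n × Fin n, (markovMinor h G c).det ≠ 0}

theorem genericallyPoleAssignable_of_mem_good (h : Bool) {m : ℕ} {G : TransferFunction n}
    (hG : G ∈ goodTransferFunctions h m n) :
    GenericallyPoleAssignable (stride h * m) (admissiblePolynomials h (stride h * m)) G := by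
  obtain ⟨⟨hdual, -, hmin⟩, c, hc⟩ := hG
  obtain ⟨S, K, C, hS, hK, -, hr⟩ := exists_selfDual_realization h hmin hdual
  refine genericallyPoleAssignable_of_det_ne_zero h hmin hS hK hr c ?_
  simpa only [markovMinor, hr, markovParameter_transferFunction] using hc

theorem markovIndex_lt (h : Bool) {m : ℕ} (j : Fin m) :
    markovIndex h j < 2 * (stride h * m) := by
  have := j.2
  cases h <;> simp only [markovIndex, stride, cond_true, cond_false] <;> omega

theorem isZariskiOpenIn_good (h : Bool) (m : ℕ) :
    IsZariskiOpenIn (markovCoords (stride h * m)) (selfDualTransferFunctions h (stride h * m) n)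
      (goodTransferFunctions h m n) := by
  refine ⟨Set.range fun c : Fin m → Fin n × Fin n => (Matrix.of fun j l : Fin m =>
    (MvPolynomial.X (⟨markovIndex h j, markovIndex_lt h j⟩, (c l).1, (c l).2) :
      MvPolynomial (Fin (2 * (stride h * m)) × Fin n × Fin n) ℂ)).det, ?_⟩
  have key (G : TransferFunction n) (c : Fin m → Fin n × Fin n) :
      MvPolynomial.eval (markovCoords (stride h * m) G) (Matrix.of fun j l : Fin m =>
        (MvPolynomial.X (⟨markovIndex h j, markovIndex_lt h j⟩, (c l).1, (c l).2) :
          MvPolynomial (Fin (2 * (stride h * m)) × Fin n × Fin n) ℂ)).det =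
      (markovMinor h G c).det := by
    rw [RingHom.map_det]
    congr 1
    ext j l
    simp [markovMinor, markovCoords]
  ext G
  simp only [goodTransferFunctions, Set.mem_ofPred_eq, Set.exists_range_iff, key]

/-- The affine family `M + s N` of matrices. -/
def affinePath {l o : Type*} (M N : Matrix l o ℂ) : Matrix l o ℂ[X] :=
  M.map C + (X : ℂ[X]) • N.map C

theorem map_affinePath {l o : Type*} (M N : Matrix l o ℂ) (t : ℂ) :
    (affinePath M N).map (evalRingHom t) = M + t • N := by
  ext i j
  simp [affinePath]
  exact mul_comm _ _

/-- The Markov parameters along an affine family of self-dual systems are polynomial. -/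
theorem exists_polynomial_markov {ι : Type*} [Fintype ι] [DecidableEq ι]
    (S₀ S₁ K₀ K₁ : Matrix ι ι ℂ) (C₀ C₁ : Matrix (Fin n) ι ℂ) (k : ℕ) (a b : Fin n) :
    ∃ q : ℂ[X], ∀ t : ℂ, q.eval t = ((C₀ + t • C₁) * ((S₀ + t • S₁) * (K₀ + t • K₁)) ^ k *
      ((S₀ + t • S₁) * (C₀ + t • C₁).transpose)) a b := by
  refine ⟨(affinePath C₀ C₁ * (affinePath S₀ S₁ * affinePath K₀ K₁) ^ k *
    (affinePath S₀ S₁ * (affinePath C₀ C₁).transpose)) a b, fun t => ?_⟩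
  have hpow (M : Matrix ι ι ℂ[X]) :
      (M ^ k).map (evalRingHom t) = M.map (evalRingHom t) ^ k :=
    map_pow (evalRingHom t).mapMatrix M k
  rw [← map_affinePath C₀, ← map_affinePath S₀, ← map_affinePath K₀, ← Matrix.transpose_map,
    ← Matrix.map_mul, ← hpow, ← Matrix.map_mul, ← Matrix.map_mul, ← Matrix.map_mul]
  rfl

theorem polynomial_eval_aeval {σ R : Type*} [CommRing R] (f : σ → R[X]) (p : MvPolynomial σ R)
    (t : R) : (MvPolynomial.aeval f p).eval t = MvPolynomial.eval (fun i => (f i).eval t) p := by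
  induction p using MvPolynomial.induction_on with
  | C a => simp
  | add f g hf hg => rw [map_add, map_add, eval_add, hf, hg]
  | mul_X g i hg => rw [map_mul, map_mul, eval_mul, hg]; simp

/-- The conditions on (S, K, C) are linear, so the line from a realization of G₀ to the explicit
system stays self-dual. Along it, the polynomial p that defines V near G₀ and the Markov determinant
are polynomials in t, nonzero at t = 0 and t = 1 respectively. At a common nonzero t the determinant
also guarantees McMillan degree δ, without any need for S to be invertible. -/
theorem isGenericIn_good (h : Bool) {m : ℕ} (hm : m ≤ (n + 1).choose 2) :
    IsGenericIn (markovCoords (stride h * m)) (selfDualTransferFunctions h (stride h * m) n)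
      (goodTransferFunctions h m n) := by
  refine ⟨isZariskiOpenIn_good h m, ?_⟩
  rintro V ⟨P, rfl⟩ ⟨G₀, ⟨hdual, -, hmin⟩, p, hpP, hp⟩
  obtain ⟨S₀, K₀, C₀, hS₀, hK₀, -, hr⟩ := exists_selfDual_realization h hmin hdual
  obtain ⟨S₁, K₁, C₁, c, hS₁, hK₁, hdet⟩ := exists_selfDual_system (n := n) h hm
  choose q hq using exists_polynomial_markov S₀ (S₁ - S₀) K₀ (K₁ - K₀) C₀ (C₁ - C₀)
  let S (t : ℂ) := S₀ + t • (S₁ - S₀)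
  let K (t : ℂ) := K₀ + t • (K₁ - K₀)
  let C (t : ℂ) := C₀ + t • (C₁ - C₀)
  let G (t : ℂ) := transferFunction (S t * K t) (S t * (C t).transpose) (C t)
  have hmark (t : ℂ) (k : ℕ) (a b : Fin n) : markovParameter (G t a b) k = (q k a b).eval t := by
    rw [hq, markovParameter_transferFunction]
  let p' : ℂ[X] := MvPolynomial.aeval
    (fun i : Fin (2 * (stride h * m)) × Fin n × Fin n => q i.1 i.2.1 i.2.2) p
  have hp' (t : ℂ) :
      p'.eval t = MvPolynomial.eval (markovCoords (stride h * m) (G t)) p := by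
    have h1 : markovCoords (stride h * m) (G t) = fun i => (q i.1 i.2.1 i.2.2).eval t :=
      funext fun i => hmark t _ _ _
    rw [h1]
    exact polynomial_eval_aeval _ _ _
  let r : ℂ[X] := (Matrix.of fun j l : Fin m => q (markovIndex h j) (c l).1 (c l).2).det
  have hr' (t : ℂ) : r.eval t = (markovMinor h (G t) c).det := by
    refine ((evalRingHom t).map_det _).trans (congrArg Matrix.det ?_)
    ext j l
    exact (hmark t _ _ _).symm
  have hp0 : p' ≠ 0 := by
    intro h0
    have h1 := hp' 0
    have h2 : G 0 = G₀ := by simp [G, S, K, C, hr]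
    rw [h0, eval_zero, h2] at h1
    exact hp h1.symm
  have hr0 : r ≠ 0 := by
    intro h0
    have h1 := hr' 1
    rw [h0, eval_zero] at h1
    apply hdet
    rw [h1]
    congr 1
    ext j l
    simp [markovMinor, G, S, K, C, markovParameter_transferFunction]
  obtain ⟨t, ht⟩ : ∃ t, (p' * r).eval t ≠ 0 := by
    by_contra! hall
    exact mul_ne_zero hp0 hr0 (Polynomial.funext fun t => by rw [hall, eval_zero])
  rw [eval_mul, hp', hr'] at ht
  have hSt : (S t).transpose = sign h • S t := by
    simp only [S, Matrix.transpose_add, Matrix.transpose_smul, Matrix.transpose_sub, hS₀, hS₁]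
    module
  have hKt : (K t).transpose = K t := by
    simp only [K, Matrix.transpose_add, Matrix.transpose_smul, Matrix.transpose_sub, hK₀, hK₁]
  have hmem := transferFunction_mem_selfDual h (C t) hSt hKt (right_ne_zero_of_mul ht)
  exact ⟨G t, ⟨hmem, c, right_ne_zero_of_mul ht⟩, hmem, p, hpP, left_ne_zero_of_mul ht⟩

theorem good_nonempty (h : Bool) {m : ℕ} (hm : m ≤ (n + 1).choose 2) :
    (goodTransferFunctions h m n).Nonempty := by
  obtain ⟨S, K, C, c, hS, hK, hdet⟩ := exists_selfDual_system (n := n) h hm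
  have hc : (markovMinor h (transferFunction (S * K) (S * C.transpose) C) c).det ≠ 0 := by
    simpa only [markovMinor, markovParameter_transferFunction] using hdet
  exact ⟨_, transferFunction_mem_selfDual h C hS hK hc, c, hc⟩

end Density

end PoleAssignment

end

/-! ### Assembly of the symmetric and Hamiltonian statements -/

theorem mainTheorem1 (n δ : ℕ) :
    ((n + 1).choose 2 < δ →
      ∀ G ∈ PoleAssignment.symmetricTransferFunctions δ n,
        ¬ PoleAssignment.PoleAssignable (PoleAssignment.monicPolynomials δ) G ∧
        ¬ PoleAssignment.RealPoleAssignable (PoleAssignment.monicPolynomials δ) G) ∧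
    (n * (n + 1) < δ →
      ∀ G ∈ PoleAssignment.hamiltonianTransferFunctions δ n,
        ¬ PoleAssignment.PoleAssignable (PoleAssignment.evenMonicPolynomials δ) G ∧
        ¬ PoleAssignment.RealPoleAssignable (PoleAssignment.evenMonicPolynomials δ) G) ∧
    (δ ≤ (n + 1).choose 2 →
      ∃ U : Set (PoleAssignment.TransferFunction n),
        U.Nonempty ∧
        PoleAssignment.IsGenericIn (PoleAssignment.markovCoords δ)
          (PoleAssignment.symmetricTransferFunctions δ n) U ∧
        ∀ G ∈ U, PoleAssignment.GenericallyPoleAssignable δ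
          (PoleAssignment.monicPolynomials δ) G) ∧
    (δ ≤ n * (n + 1) →
      ∃ U : Set (PoleAssignment.TransferFunction n),
        (Even δ → U.Nonempty) ∧
        PoleAssignment.IsGenericIn (PoleAssignment.markovCoords δ)
          (PoleAssignment.hamiltonianTransferFunctions δ n) U ∧
        ∀ G ∈ U, PoleAssignment.GenericallyPoleAssignable δ
          (PoleAssignment.evenMonicPolynomials δ) G) := by
  have hchoose : 2 * (n + 1).choose 2 = n * (n + 1) := by
    rw [Nat.choose_two_right, Nat.add_sub_cancel, mul_comm (n + 1)]
    exact Nat.mul_div_cancel' (Nat.even_mul_succ_self n).two_dvd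
  refine ⟨fun hδ G hG => ?_, fun hδ G hG => ?_, fun hδ => ?_, fun hδ => ?_⟩
  · obtain ⟨m, rfl⟩ : ∃ m, δ = PoleAssignment.stride false * m := ⟨δ, (one_mul δ).symm⟩
    exact PoleAssignment.not_poleAssignable false hG.2.2 (by rwa [← one_mul m])
  · obtain ⟨m, rfl⟩ : ∃ m, δ = PoleAssignment.stride true * m :=
      (PoleAssignment.even_of_hamiltonian hG.2.2 hG.1).two_dvd
    refine PoleAssignment.not_poleAssignable true hG.2.2 ?_
    simp only [PoleAssignment.stride, cond_true] at hδ
    omega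
  · obtain ⟨m, rfl⟩ : ∃ m, δ = PoleAssignment.stride false * m := ⟨δ, (one_mul δ).symm⟩
    have hm : m ≤ (n + 1).choose 2 := by rwa [← one_mul m]
    exact ⟨PoleAssignment.goodTransferFunctions false m n, PoleAssignment.good_nonempty false hm,
      PoleAssignment.isGenericIn_good false hm,
      fun G hG => PoleAssignment.genericallyPoleAssignable_of_mem_good false hG⟩
  · by_cases heven : Even δ
    · obtain ⟨m, rfl⟩ : ∃ m, δ = PoleAssignment.stride true * m := heven.two_dvd
      have hm : m ≤ (n + 1).choose 2 := by
        simp only [PoleAssignment.stride, cond_true] at hδ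
        omega
      exact ⟨PoleAssignment.goodTransferFunctions true m n,
        fun _ => PoleAssignment.good_nonempty true hm, PoleAssignment.isGenericIn_good true hm,
        fun G hG => PoleAssignment.genericallyPoleAssignable_of_mem_good true hG⟩
    -- For odd δ there are no Hamiltonian transfer functions, so the empty set is generic.
    · refine ⟨∅, fun h => absurd h heven, ⟨⟨∅, by simp⟩, ?_⟩, fun G hG => hG.elim⟩
      rintro V ⟨P, rfl⟩ ⟨G, hG, -⟩
      exact absurd (PoleAssignment.even_of_hamiltonian hG.2.2 hG.1) heven
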